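/- Let $f\in C^{1,\epsilon}([0,1])$ be of KPP type: $f(0)=f(1)=0$, $f$ is non-increasing on $(1-\epsilon,1)$ for some $\epsilon>0$, and $0<f(s)\le s f'(0)$ for $s\in(0,1)$. Let $A>0$ and put $\tau=2\sqrt{f'(0)}$. Let $V:\mathbb R^n\to\mathbb R^n$ be smooth, $\mathbb Z^n$-periodic, divergence free and of mean zero over the unit cell, and let $p\in\mathbb R^n$. For $a>0$ let $\alpha_a(p)$ be the unique number such that the cell problem $$|p+DG|+aV(x)\cdot(p+DG)=\alpha_a(p)$$ admits approximate periodic viscosity solutions (i.e. for every $\epsilon>0$ there is a continuous periodic function which is a viscosity subsolution of the equation with right-hand side $\alpha_a(p)+\epsilon$ and a viscosity supersolution of the equation with right-hand side $\alpha_a(p)-\epsilon$); it is the turbulent flame speed of the G-equation. Let $\beta_A(p)$ be the unique number such that $$|p+DF|^2+AV(x)\cdot(p+DF)=\beta_A(p)$$ admits a continuous periodic viscosity solution, and let $$\gamma_A(p)=\inf_{\lambda>0}\frac{f'(0)+\beta_A(\lambda p)}{\lambda}$$ be the turbulent flame speed of the F-equation (Majda–Souganidis) model. Then $$\tau\,\alpha_{A/\tau}(p)\le\gamma_A(p)\le\beta_A(p)+f'(0),$$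 and if $f'(0)\ge\frac14$, then $\gamma_A(p)\ge\alpha_A(p)$. The last conclusion can fail if $f'(0)<\frac14$: let $n=2$, $V(x_1,x_2)=(v(x_2),0)$ with $v:\mathbb R\to\mathbb R$ smooth, $1$-periodic and $\int_0^1 v=0$, and $p=(1,0)$. Then $\alpha_A(p)=1+A\max v$, $\beta_A(\lambda p)=\lambda^2+A\lambda\max v$ for all $\lambda>0$, and $\gamma_A(p)=A\max v+2\sqrt{f'(0)}$; in particular $\gamma_A(p)<\alpha_A(p)$ whenever $f'(0)<\frac14$. -/

import Mathlib

open scoped ContDiff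

/-- `ℤⁿ`-periodic functions on `ℝⁿ`, i.e. functions on the flat torus `𝕋ⁿ = ℝⁿ/ℤⁿ`. -/
def TorusPeriodic {n : ℕ} {β : Type*} (g : EuclideanSpace ℝ (Fin n) → β) : Prop :=
  ∀ (x : EuclideanSpace ℝ (Fin n)) (k : Fin n → ℤ),
    g (x + WithLp.toLp 2 (fun i => (k i : ℝ))) = g x

/-- The velocity fields under consideration: smooth, `ℤⁿ`-periodic, divergence free, with
mean zero over the unit cell. -/
structure IsIncompressibleFlow {n : ℕ}
    (V : EuclideanSpace ℝ (Fin n) → EuclideanSpace ℝ (Fin n)) : Prop where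
  smooth : ContDiff ℝ ∞ V
  periodic : TorusPeriodic V
  div_free : ∀ x, ∑ i, (fderiv ℝ V x (EuclideanSpace.single i 1)) i = 0
  mean_zero : ∫ x in {x : EuclideanSpace ℝ (Fin n) | ∀ i, x i ∈ Set.Icc (0 : ℝ) 1}, V x = 0

/-- `f'(0)` for a function on `[0,1]` (the one-sided derivative at `0`). -/
noncomputable def reactionRate (f : ℝ → ℝ) : ℝ := derivWithin f (Set.Icc 0 1) 0

/-- KPP type nonlinearities on `[0,1]`: `f ∈ C^{1,ε}([0,1])`, `f(0) = f(1) = 0`, `f` is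
non-increasing on `(1-ε,1)` for some `ε > 0`, and `0 < f(s) ≤ s f'(0)` on `(0,1)`. Only the values
of `f` on `[0,1]` matter. -/
structure IsKPP (f : ℝ → ℝ) : Prop where
  differentiableOn : DifferentiableOn ℝ f (Set.Icc 0 1)
  holder_deriv : ∃ C r : NNReal, 0 < r ∧ r ≤ 1 ∧
    HolderOnWith C r (derivWithin f (Set.Icc 0 1)) (Set.Icc 0 1)
  zero : f 0 = 0
  one : f 1 = 0
  antitone_near_one : ∃ ε : ℝ, 0 < ε ∧ AntitoneOn f (Set.Ioo (1 - ε) 1)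
  pos : ∀ s ∈ Set.Ioo (0 : ℝ) 1, 0 < f s
  le_linear : ∀ s ∈ Set.Ioo (0 : ℝ) 1, f s ≤ s * reactionRate f

/-- `u ∈ C(ℝⁿ)` is a viscosity subsolution of `H(Du, x) = 0` in `ℝⁿ`: whenever `φ ∈ C¹` and
`φ - u` attains its minimum at `x₀`, `H(Dφ(x₀), x₀) ≤ 0`. -/
def IsViscositySubsolution {n : ℕ}
    (H : EuclideanSpace ℝ (Fin n) → EuclideanSpace ℝ (Fin n) → ℝ)
    (u : EuclideanSpace ℝ (Fin n) → ℝ) : Prop :=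
  Continuous u ∧ ∀ φ : EuclideanSpace ℝ (Fin n) → ℝ, ContDiff ℝ 1 φ → ∀ x₀,
    (∀ x, φ x₀ - u x₀ ≤ φ x - u x) → H (gradient φ x₀) x₀ ≤ 0

/-- `u ∈ C(ℝⁿ)` is a viscosity supersolution of `H(Du, x) = 0` in `ℝⁿ`: whenever `φ ∈ C¹` and
`φ - u` attains its maximum at `x₀`, `H(Dφ(x₀), x₀) ≥ 0`. -/
def IsViscositySupersolution {n : ℕ}
    (H : EuclideanSpace ℝ (Fin n) → EuclideanSpace ℝ (Fin n) → ℝ)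
    (u : EuclideanSpace ℝ (Fin n) → ℝ) : Prop :=
  Continuous u ∧ ∀ φ : EuclideanSpace ℝ (Fin n) → ℝ, ContDiff ℝ 1 φ → ∀ x₀,
    (∀ x, φ x - u x ≤ φ x₀ - u x₀) → 0 ≤ H (gradient φ x₀) x₀

/-- The cell problem `H(p + Du, x) = c` admits a periodic viscosity solution. -/
def AdmitsPeriodicSolution {n : ℕ}
    (H : EuclideanSpace ℝ (Fin n) → EuclideanSpace ℝ (Fin n) → ℝ)
    (p : EuclideanSpace ℝ (Fin n)) (c : ℝ) : Prop :=
  ∃ u : EuclideanSpace ℝ (Fin n) → ℝ, TorusPeriodic u ∧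
    IsViscositySubsolution (fun P x => H (p + P) x - c) u ∧
    IsViscositySupersolution (fun P x => H (p + P) x - c) u

/-- The cell problem `H(p + Du, x) = c` admits approximate periodic viscosity solutions: for every
`ε > 0` there is a periodic `u` which is a subsolution of `H(p + Du, x) = c + ε` and a
supersolution of `H(p + Du, x) = c - ε`. -/
def AdmitsApproxPeriodicSolutions {n : ℕ}
    (H : EuclideanSpace ℝ (Fin n) → EuclideanSpace ℝ (Fin n) → ℝ)
    (p : EuclideanSpace ℝ (Fin n)) (c : ℝ) : Prop :=
  ∀ ε : ℝ, 0 < ε → ∃ u : EuclideanSpace ℝ (Fin n) → ℝ, TorusPeriodic u ∧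
    IsViscositySubsolution (fun P x => H (p + P) x - (c + ε)) u ∧
    IsViscositySupersolution (fun P x => H (p + P) x - (c - ε)) u

open Classical in
/-- The unique real number with property `P` (and `0` if there is no such unique number). -/
noncomputable def theUniqueNumber (P : ℝ → Prop) : ℝ :=
  if h : ∃! c, P c then h.choose else 0

/-- Hamiltonian of the inviscid G-equation with flow `A V`: `|P| + A V(x) · P`. -/
noncomputable def hamiltonianG {n : ℕ}
    (V : EuclideanSpace ℝ (Fin n) → EuclideanSpace ℝ (Fin n)) (A : ℝ)
    (P x : EuclideanSpace ℝ (Fin n)) : ℝ :=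
  ‖P‖ + A * inner ℝ (V x) P

/-- Hamiltonian of the inviscid F-equation with flow `A V`: `|P|² + A V(x) · P`. -/
noncomputable def hamiltonianF {n : ℕ}
    (V : EuclideanSpace ℝ (Fin n) → EuclideanSpace ℝ (Fin n)) (A : ℝ)
    (P x : EuclideanSpace ℝ (Fin n)) : ℝ :=
  ‖P‖ ^ 2 + A * inner ℝ (V x) P

/-- `α_A(p)`: the unique number `c` such that `|p + DG| + A V(x) · (p + DG) = c` admits
approximate periodic viscosity solutions (turbulent flame speed of the G-equation). -/
noncomputable def speedG {n : ℕ}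
    (V : EuclideanSpace ℝ (Fin n) → EuclideanSpace ℝ (Fin n)) (A : ℝ)
    (p : EuclideanSpace ℝ (Fin n)) : ℝ :=
  theUniqueNumber (AdmitsApproxPeriodicSolutions (hamiltonianG V A) p)

/-- `β_A(p)`: the unique number `c` such that `|p + DF|² + A V(x) · (p + DF) = c` admits
periodic viscosity solutions (effective Hamiltonian of the F-equation). -/
noncomputable def effectiveF {n : ℕ}
    (V : EuclideanSpace ℝ (Fin n) → EuclideanSpace ℝ (Fin n)) (A : ℝ)
    (p : EuclideanSpace ℝ (Fin n)) : ℝ :=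
  theUniqueNumber (AdmitsPeriodicSolution (hamiltonianF V A) p)

/-- `γ_A(p) = inf_{l > 0} (f'(0) + β_A(l p)) / l`: turbulent flame speed of the
Majda-Souganidis model. -/
noncomputable def speedMS {n : ℕ} (f : ℝ → ℝ)
    (V : EuclideanSpace ℝ (Fin n) → EuclideanSpace ℝ (Fin n)) (A : ℝ)
    (p : EuclideanSpace ℝ (Fin n)) : ℝ :=
  ⨅ l : Set.Ioi (0 : ℝ), (reactionRate f + effectiveF V A ((l : ℝ) • p)) / (l : ℝ)

/-!
The inequalities between the flame speeds come from `2 √f'(0) |P| ≤ |P|² + f'(0)` (and from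
`|P| ≤ |P|² + f'(0)` when `f'(0) ≥ 1/4`): by it, a corrector of the F-equation with slope `l p`,
divided by `l`, is a subsolution of a G-equation with slope `p`, and comparison with approximate
supersolutions bounds the G-speed by `(f'(0) + β(l p)) / l` (`mul_speedG_le`). The upper bound is
the choice `l = 1`. For shear flows, constants are subsolutions and steep multiples of the distance
to the line where the shear is maximal are supersolutions (`tentFunction_touching`), so that both
speeds can be read off.

These arguments are about the actual speeds only once the cell problems are known to determine their
constants, which is the bulk of the file (`speedG_spec`, `effectiveF_spec`). Uniqueness is doubling
of variables (`exists_doubling`). For existence, the discounted equation `l u + H(Du, x) = 0` is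
solved by Perron's method (`exists_discounted_solution`), and `l → 0` yields approximate correctors
as soon as the oscillation of the discounted solutions is bounded (`exists_approx_correctors`). The
Hamiltonian of the F-equation is coercive, so its subsolutions are equi-Lipschitz; this bounds the
oscillation, and a compactness argument gives exact correctors.

The Hamiltonian of the G-equation is not coercive when the flow is strong, and the oscillation bound
`exists_oscillation_bound` uses that the flow `b` is incompressible. A subsolution `u` of
`|Du| + b · Du ≤ K` satisfies upper bounds which are transported along `b` while spreading at a
fixed speed (`IsSubsol.le_on_moving_ball`). Hence a sublevel set of `u`, moved by the Euler scheme
`z ↦ z + h b(z)` for a fixed time and enlarged by a fixed radius, is contained in a higher sublevel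
set. Since `det (1 + h Db) = 1 + o(h)`, the Euler scheme loses an arbitrarily small proportion of
volume as `h → 0`, while the enlargement gains the volume of a fixed ball unless it covers
everything. After boundedly many rounds the sublevel set is the whole torus.
-/

open scoped ContDiff RealInnerProductSpace Pointwise
open Filter Topology MeasureTheory

/-! ### Test functions and the notion of sub- and supersolution -/

/-- Euclidean space `ℝⁿ`. -/
abbrev Euc (n : ℕ) := EuclideanSpace ℝ (Fin n)

/-- The touching condition for a viscosity subsolution of `F(u, Du, x) = 0`. No continuity of `u` is
built in, so that the notion also applies to semicontinuous functions. -/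
def IsSubsol {n : ℕ} (F : ℝ → Euc n → Euc n → ℝ) (u : Euc n → ℝ) : Prop :=
  ∀ φ : Euc n → ℝ, ContDiff ℝ 1 φ → ∀ x₀, (∀ x, u x - φ x ≤ u x₀ - φ x₀) →
    F (u x₀) (gradient φ x₀) x₀ ≤ 0

/-- The touching condition for a viscosity supersolution of `F(u, Du, x) = 0`, without any
continuity of `u`. -/
def IsSupersol {n : ℕ} (F : ℝ → Euc n → Euc n → ℝ) (u : Euc n → ℝ) : Prop :=
  ∀ φ : Euc n → ℝ, ContDiff ℝ 1 φ → ∀ x₀, (∀ x, u x₀ - φ x₀ ≤ u x - φ x) →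
    0 ≤ F (u x₀) (gradient φ x₀) x₀

section Gradient
variable {n : ℕ}

lemma hasGradientAt_const_mul_norm_sub_sq (c : ℝ) (y z : Euc n) :
    HasGradientAt (fun x : Euc n => c * ‖x - y‖ ^ 2) ((2 * c) • (z - y)) z := by
  rw [hasGradientAt_iff_hasFDerivAt]
  have h := (((hasFDerivAt_id (𝕜 := ℝ) z).sub_const y).norm_sq).const_mul c
  refine h.congr_fderiv ?_
  ext w
  simp
  ring

lemma contDiff_const_mul_norm_sub_sq (c : ℝ) (y : Euc n) :
    ContDiff ℝ 1 (fun x : Euc n => c * ‖x - y‖ ^ 2) :=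
  contDiff_const.mul ((contDiff_id.sub contDiff_const).norm_sq ℝ)

lemma ContDiff.hasGradientAt {φ : Euc n → ℝ} (hφ : ContDiff ℝ 1 φ) (z : Euc n) :
    HasGradientAt φ (gradient φ z) z :=
  (hφ.differentiable (by norm_num) z).hasGradientAt

lemma HasGradientAt.add_fun {φ ψ : Euc n → ℝ} {P Q z : Euc n} (h : HasGradientAt φ P z)
    (h' : HasGradientAt ψ Q z) : HasGradientAt (fun x => φ x + ψ x) (P + Q) z := by
  rw [hasGradientAt_iff_hasFDerivAt] at *
  rw [map_add]
  exact h.add h'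

lemma HasGradientAt.neg_fun {φ : Euc n → ℝ} {P z : Euc n} (h : HasGradientAt φ P z) :
    HasGradientAt (fun x => - φ x) (-P) z := by
  rw [hasGradientAt_iff_hasFDerivAt] at *
  rw [map_neg]
  exact h.neg

lemma HasGradientAt.const_mul_fun {φ : Euc n → ℝ} {P z : Euc n} (c : ℝ) (h : HasGradientAt φ P z) :
    HasGradientAt (fun x => c * φ x) (c • P) z := by
  rw [hasGradientAt_iff_hasFDerivAt] at *
  rw [map_smul]
  exact h.const_mul c

lemma continuous_gradient {φ : Euc n → ℝ} (hφ : ContDiff ℝ 1 φ) : Continuous (gradient φ) :=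
  (InnerProductSpace.toDual ℝ (Euc n)).symm.continuous.comp (hφ.continuous_fderiv (by norm_num))

lemma IsSubsol.apply {F : ℝ → Euc n → Euc n → ℝ} {u : Euc n → ℝ} (hu : IsSubsol F u)
    {φ : Euc n → ℝ} (hφ : ContDiff ℝ 1 φ) {P x₀ : Euc n} (hP : HasGradientAt φ P x₀)
    (hmax : ∀ x, u x - φ x ≤ u x₀ - φ x₀) : F (u x₀) P x₀ ≤ 0 := by
  have := hu φ hφ x₀ hmax
  rwa [hP.gradient] at this

lemma IsSupersol.apply {F : ℝ → Euc n → Euc n → ℝ} {u : Euc n → ℝ} (hu : IsSupersol F u)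
    {φ : Euc n → ℝ} (hφ : ContDiff ℝ 1 φ) {P x₀ : Euc n} (hP : HasGradientAt φ P x₀)
    (hmin : ∀ x, u x₀ - φ x₀ ≤ u x - φ x) : 0 ≤ F (u x₀) P x₀ := by
  have := hu φ hφ x₀ hmin
  rwa [hP.gradient] at this

lemma IsSupersol.neg {F : ℝ → Euc n → Euc n → ℝ} {u : Euc n → ℝ} (hu : IsSupersol F u) :
    IsSubsol (fun r P x => - F (-r) (-P) x) (fun x => - u x) := by
  intro φ hφ x₀ hmax
  have := hu.apply hφ.neg (hφ.hasGradientAt x₀).neg_fun (x₀ := x₀) (fun x => by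
    have := hmax x
    linarith)
  simpa using this

lemma IsSubsol.neg {F : ℝ → Euc n → Euc n → ℝ} {u : Euc n → ℝ} (hu : IsSubsol F u) :
    IsSupersol (fun r P x => - F (-r) (-P) x) (fun x => - u x) := by
  intro φ hφ x₀ hmax
  have := hu.apply hφ.neg (hφ.hasGradientAt x₀).neg_fun (x₀ := x₀) (fun x => by
    have := hmax x
    linarith)
  simpa using this

lemma IsSubsol.mono {F G : ℝ → Euc n → Euc n → ℝ} {u : Euc n → ℝ} (hu : IsSubsol F u)
    (h : ∀ P x, G (u x) P x ≤ F (u x) P x) : IsSubsol G u :=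
  fun φ hφ x₀ hmax => (h _ _).trans (hu φ hφ x₀ hmax)

lemma IsSupersol.mono {F G : ℝ → Euc n → Euc n → ℝ} {u : Euc n → ℝ} (hu : IsSupersol F u)
    (h : ∀ P x, F (u x) P x ≤ G (u x) P x) : IsSupersol G u :=
  fun φ hφ x₀ hmin => (hu φ hφ x₀ hmin).trans (h _ _)

lemma IsSubsol.sub_const {F : ℝ → Euc n → Euc n → ℝ} {u : Euc n → ℝ} (hu : IsSubsol F u) (c : ℝ) :
    IsSubsol (fun r P x => F (r + c) P x) (fun x => u x - c) := by
  intro φ hφ x₀ hmax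
  simpa using hu φ hφ x₀ (fun x => by have := hmax x; linarith)

lemma IsSupersol.sub_const {F : ℝ → Euc n → Euc n → ℝ} {u : Euc n → ℝ} (hu : IsSupersol F u)
    (c : ℝ) : IsSupersol (fun r P x => F (r + c) P x) (fun x => u x - c) := by
  intro φ hφ x₀ hmin
  simpa using hu φ hφ x₀ (fun x => by have := hmin x; linarith)

lemma isViscositySubsolution_iff {H : Euc n → Euc n → ℝ} {u : Euc n → ℝ} :
    IsViscositySubsolution H u ↔ Continuous u ∧ IsSubsol (fun _ P x => H P x) u := by
  refine and_congr_right fun _ => forall_congr' fun φ => forall_congr' fun _ =>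
    forall_congr' fun x₀ => imp_congr_left (forall_congr' fun x => ?_)
  constructor <;> intro h <;> linarith

lemma isViscositySupersolution_iff {H : Euc n → Euc n → ℝ} {u : Euc n → ℝ} :
    IsViscositySupersolution H u ↔ Continuous u ∧ IsSupersol (fun _ P x => H P x) u := by
  refine and_congr_right fun _ => forall_congr' fun φ => forall_congr' fun _ =>
    forall_congr' fun x₀ => imp_congr_left (forall_congr' fun x => ?_)
  constructor <;> intro h <;> linarith

end Gradient

/-! ### Stability of viscosity subsolutions -/

section Stability
variable {n : ℕ}

/-- Stability of the subsolution test: if `U - φ` is maximal at `x₀` and `U` is approximated near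
`x₀` by continuous almost-subsolutions lying almost below `U`, then the subsolution inequality holds
for `U` and `φ` at `x₀`. -/
theorem subsol_test_of_approx {F : ℝ → Euc n → Euc n → ℝ}
    (hF : Continuous fun q : ℝ × Euc n × Euc n => F q.1 q.2.1 q.2.2) {U φ : Euc n → ℝ}
    (hφ : ContDiff ℝ 1 φ) {x₀ : Euc n} (hmax : ∀ x, U x - φ x ≤ U x₀ - φ x₀)
    (happ : ∀ ε : ℝ, 0 < ε → ∃ v : Euc n → ℝ, Continuous v ∧
      IsSubsol (fun r P x => F r P x - ε) v ∧ (∀ x, v x ≤ U x + ε) ∧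
      ∃ y, ‖y - x₀‖ ≤ ε ∧ U x₀ - ε ≤ v y) :
    F (U x₀) (gradient φ x₀) x₀ ≤ 0 := by
  -- The penalization by `‖x - x₀‖²` makes the maximum strict, hence stable.
  have main : ∀ ε : ℝ, 0 < ε → ∃ y z : Euc n, ∃ r : ℝ, ‖y - x₀‖ ≤ ε ∧
      ‖z - x₀‖ ^ 2 ≤ 2 * ε + ε ^ 2 + (φ y - φ x₀) ∧ r - U x₀ ≤ ε + (φ z - φ x₀) ∧
      - ε - (φ y - φ x₀) - ε ^ 2 + (φ z - φ x₀) ≤ r - U x₀ ∧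
      F r (gradient φ z + (2 * 1 : ℝ) • (z - x₀)) z ≤ ε := by
    intro ε hε
    obtain ⟨v, hvc, hv, hvU, y, hy, hvy⟩ := happ ε hε
    have hφ' : ContDiff ℝ 1 (fun x => φ x + 1 * ‖x - x₀‖ ^ 2) :=
      hφ.add (contDiff_const_mul_norm_sub_sq 1 x₀)
    set g : Euc n → ℝ := fun x => v x - (φ x + 1 * ‖x - x₀‖ ^ 2) with hg
    have hgc : Continuous g := hvc.sub hφ'.continuous
    have hub : ∀ x, g x ≤ U x₀ - φ x₀ + ε - ‖x - x₀‖ ^ 2 := by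
      intro x
      have h1 := hvU x
      have h2 := hmax x
      simp only [hg]; linarith
    obtain ⟨z, hz⟩ := hgc.exists_forall_ge' y (by
      set R : ℝ := 1 + |U x₀ - φ x₀ + ε - g y|
      have hR1 : 1 ≤ R := by simp [R]
      filter_upwards [(isCompact_closedBall x₀ R).compl_mem_cocompact] with x hx
      have hx' : R < ‖x - x₀‖ := by simpa [dist_eq_norm] using hx
      have h1 := hub x
      have h2 : R ≤ ‖x - x₀‖ ^ 2 := by nlinarith
      have h3 := le_abs_self (U x₀ - φ x₀ + ε - g y)
      simp only [R] at h2
      linarith)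
    have hy2 : ‖y - x₀‖ ^ 2 ≤ ε ^ 2 := by gcongr
    have hzy := hz y
    have hzu := hub z
    have h1 := hvU z
    have h2 := hmax z
    have h3 : 0 ≤ ‖z - x₀‖ ^ 2 := by positivity
    simp only [hg] at hzy hzu
    refine ⟨y, z, v z, hy, by linarith, by linarith, by linarith, ?_⟩
    have := hv.apply hφ' ((hφ.hasGradientAt z).add_fun
      (hasGradientAt_const_mul_norm_sub_sq 1 x₀ z)) (fun x => hz x)
    linarith
  choose! y z r hy hz hr1 hr2 hFr using main
  set e : ℕ → ℝ := fun k => 1 / ((k : ℝ) + 1) with he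
  have hepos : ∀ k, 0 < e k := fun k => by simp only [he]; positivity
  have he0 : Tendsto e atTop (𝓝 0) := tendsto_one_div_add_atTop_nhds_zero_nat
  have hφc := hφ.continuous
  have hyl : Tendsto (fun k => y (e k)) atTop (𝓝 x₀) := by
    rw [tendsto_iff_norm_sub_tendsto_zero]
    exact squeeze_zero (fun _ => norm_nonneg _) (fun k => hy _ (hepos k)) he0
  have hφy : Tendsto (fun k => φ (y (e k)) - φ x₀) atTop (𝓝 0) := by
    simpa using ((hφc.tendsto x₀).comp hyl).sub_const (φ x₀)
  have hzl : Tendsto (fun k => z (e k)) atTop (𝓝 x₀) := by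
    rw [tendsto_iff_norm_sub_tendsto_zero]
    have h2 : Tendsto (fun k => ‖z (e k) - x₀‖ ^ 2) atTop (𝓝 0) := by
      refine squeeze_zero (fun _ => by positivity) (fun k => hz _ (hepos k)) ?_
      simpa using ((he0.const_mul 2).add (he0.pow 2)).add hφy
    have := (Real.continuous_sqrt.tendsto _).comp h2
    simpa [Function.comp_def] using this
  have hφz : Tendsto (fun k => φ (z (e k)) - φ x₀) atTop (𝓝 0) := by
    simpa using ((hφc.tendsto x₀).comp hzl).sub_const (φ x₀)
  have hrl : Tendsto (fun k => r (e k)) atTop (𝓝 (U x₀)) := by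
    have : Tendsto (fun k => r (e k) - U x₀) atTop (𝓝 0) := by
      refine tendsto_of_tendsto_of_tendsto_of_le_of_le ?_ ?_ (fun k => hr2 _ (hepos k))
        (fun k => hr1 _ (hepos k))
      · simpa using ((he0.neg.sub hφy).sub (he0.pow 2)).add hφz
      · simpa using he0.add hφz
    simpa using this.add_const (U x₀)
  have hgl : Tendsto (fun k => gradient φ (z (e k)) + (2 * 1 : ℝ) • (z (e k) - x₀)) atTop
      (𝓝 (gradient φ x₀)) := by
    simpa using (((continuous_gradient hφ).tendsto x₀).comp hzl).add
      ((hzl.sub_const x₀).const_smul (2 * 1 : ℝ))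
  exact le_of_tendsto_of_tendsto' ((hF.tendsto (U x₀, gradient φ x₀, x₀)).comp
    (hrl.prodMk_nhds (hgl.prodMk_nhds hzl))) he0 (fun k => hFr _ (hepos k))

/-- Uniform limits of continuous almost-subsolutions are subsolutions. -/
theorem IsSubsol.of_uniform_limit {F : ℝ → Euc n → Euc n → ℝ}
    (hF : Continuous fun q : ℝ × Euc n × Euc n => F q.1 q.2.1 q.2.2) {U : Euc n → ℝ}
    (happ : ∀ ε : ℝ, 0 < ε → ∃ v : Euc n → ℝ, Continuous v ∧
      IsSubsol (fun r P x => F r P x - ε) v ∧ ∀ x, |v x - U x| ≤ ε) : IsSubsol F U := by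
  intro φ hφ x₀ hmax
  refine subsol_test_of_approx hF hφ hmax fun ε hε => ?_
  obtain ⟨v, hvc, hv, h⟩ := happ ε hε
  refine ⟨v, hvc, hv, fun x => ?_, x₀, by simpa using hε.le, ?_⟩
  · linarith [(abs_le.1 (h x)).2]
  · linarith [(abs_le.1 (h x₀)).1]

theorem IsSupersol.of_uniform_limit {F : ℝ → Euc n → Euc n → ℝ}
    (hF : Continuous fun q : ℝ × Euc n × Euc n => F q.1 q.2.1 q.2.2) {U : Euc n → ℝ}
    (happ : ∀ ε : ℝ, 0 < ε → ∃ v : Euc n → ℝ, Continuous v ∧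
      IsSupersol (fun r P x => F r P x + ε) v ∧ ∀ x, |v x - U x| ≤ ε) : IsSupersol F U := by
  have : IsSubsol (fun r P x => - F (-r) (-P) x) (fun x => - U x) := by
    refine IsSubsol.of_uniform_limit ?_ fun ε hε => ?_
    · exact (hF.comp (by fun_prop :
        Continuous fun q : ℝ × Euc n × Euc n => (-q.1, -q.2.1, q.2.2))).neg
    · obtain ⟨v, hvc, hv, h⟩ := happ ε hε
      refine ⟨fun x => - v x, hvc.neg, hv.neg.mono fun P x => by linarith, fun x => ?_⟩
      rw [← abs_neg]
      convert h x using 2; ring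
  simpa using this.neg

end Stability

/-! ### Periodic functions -/

section Torus
variable {n : ℕ}

/-- The vector of `ℝⁿ` with the integer coordinates `k`. -/
def intVec (k : Fin n → ℤ) : Euc n := WithLp.toLp 2 (fun i => (k i : ℝ))

@[simp] lemma intVec_apply (k : Fin n → ℤ) (i : Fin n) : intVec k i = k i := rfl

lemma intVec_neg (k : Fin n → ℤ) : intVec (-k) = - intVec k := by
  ext i; simp

lemma TorusPeriodic.add_intVec {β : Type*} {g : Euc n → β} (hg : TorusPeriodic g) (x : Euc n)
    (k : Fin n → ℤ) : g (x + intVec k) = g x := hg x k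

/-- Every point has an integer translate within distance `√n` of the origin. -/
lemma exists_norm_add_intVec_le (x : Euc n) : ∃ k : Fin n → ℤ, ‖x + intVec k‖ ≤ √n := by
  refine ⟨fun i => -⌊x i⌋, ?_⟩
  rw [EuclideanSpace.norm_eq]
  refine Real.sqrt_le_sqrt ?_
  calc ∑ i, ‖(x + intVec fun i => -⌊x i⌋) i‖ ^ 2 ≤ ∑ _i : Fin n, (1 : ℝ) := by
        refine Finset.sum_le_sum fun i _ => ?_
        have h1 := Int.fract_nonneg (x i)
        have h2 := (Int.fract_lt_one (x i)).le
        have : (x + intVec fun i => -⌊x i⌋) i = Int.fract (x i) := by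
          simp [Int.fract, sub_eq_add_neg]
        rw [this, Real.norm_of_nonneg h1]
        nlinarith
    _ = n := by simp

lemma TorusPeriodic.exists_bound {β : Type*} [SeminormedAddCommGroup β] {g : Euc n → β}
    (hg : TorusPeriodic g) (hc : Continuous g) : ∃ B : ℝ, 0 ≤ B ∧ ∀ x, ‖g x‖ ≤ B := by
  obtain ⟨B, hB⟩ := (isCompact_closedBall (0 : Euc n) (√n)).exists_bound_of_continuousOn
    hc.continuousOn
  refine ⟨|B|, abs_nonneg B, fun x => ?_⟩
  obtain ⟨k, hk⟩ := exists_norm_add_intVec_le x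
  rw [← hg.add_intVec x k]
  exact (hB _ (by simpa using hk)).trans (le_abs_self B)

end Torus

/-! ### Doubling of variables -/

section Doubling
variable {n : ℕ}

lemma upperSemicontinuous_neg {W : Euc n → ℝ} (hW : LowerSemicontinuous W) :
    UpperSemicontinuous fun x => - W x := fun x y hy =>
  (hW x (-y) (by simp only at hy; linarith)).mono fun z hz => by simp only; linarith

/-- The doubled functional `U x - W y - κ ‖x - y‖²` attains its maximum. -/
lemma exists_max_doubled {U W : Euc n → ℝ} (hUp : TorusPeriodic U) (hWp : TorusPeriodic W)
    (hU : UpperSemicontinuous U) (hW : LowerSemicontinuous W) {B : ℝ} (hUB : ∀ x, |U x| ≤ B)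
    (hWB : ∀ x, |W x| ≤ B) {κ : ℝ} (hκ : 1 ≤ κ) :
    ∃ x y : Euc n, ∀ x' y', U x' - W y' - κ * ‖x' - y'‖ ^ 2 ≤ U x - W y - κ * ‖x - y‖ ^ 2 := by
  have hB : 0 ≤ B := (abs_nonneg _).trans (hUB 0)
  set D : ℝ := 4 * B + 1
  set K : Set (Euc n × Euc n) := Metric.closedBall 0 (√n) ×ˢ Metric.closedBall 0 (√n + D)
  have hK : IsCompact K := (isCompact_closedBall _ _).prod (isCompact_closedBall _ _)
  set f : Euc n × Euc n → ℝ := fun q => U q.1 + -W q.2 + -(κ * ‖q.1 - q.2‖ ^ 2)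
  have hf : UpperSemicontinuous f := by
    refine UpperSemicontinuous.add (UpperSemicontinuous.add ?_ ?_) ?_
    · exact fun x y hy => (continuous_fst.tendsto x).eventually (hU x.1 y hy)
    · exact fun x y hy => (continuous_snd.tendsto x).eventually
        (upperSemicontinuous_neg hW x.2 y hy)
    · exact Continuous.upperSemicontinuous (by fun_prop)
  obtain ⟨⟨x, y⟩, -, hmax⟩ := UpperSemicontinuousOn.exists_isMaxOn (s := K)
    ⟨(0, 0), by simp [K]; positivity⟩ hK (hf.upperSemicontinuousOn K)
  have hmax' : ∀ x' y', (x', y') ∈ K → U x' - W y' - κ * ‖x' - y'‖ ^ 2 ≤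
      U x - W y - κ * ‖x - y‖ ^ 2 := fun x' y' h => by
    have := hmax h
    simp only [Set.mem_ofPred_eq, f] at this; linarith
  refine ⟨x, y, fun x' y' => ?_⟩
  obtain ⟨k, hk⟩ := exists_norm_add_intVec_le x'
  rw [← hUp.add_intVec x' k, ← hWp.add_intVec y' k,
    ← add_sub_add_right_eq_sub x' y' (intVec k)]
  by_cases hd : ‖x' + intVec k - (y' + intVec k)‖ ≤ D
  · refine hmax' _ _ ⟨by simpa using hk, ?_⟩
    have : y' + intVec k = (x' + intVec k) - (x' + intVec k - (y' + intVec k)) := by abel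
    rw [this, mem_closedBall_zero_iff]
    exact (norm_sub_le _ _).trans (by gcongr)
  · push Not at hd
    have h0 := hmax' 0 0 (by simp [K]; positivity)
    simp only [sub_zero, norm_zero] at h0
    have h1 := abs_le.1 (hUB (x' + intVec k))
    have h2 := abs_le.1 (hWB (y' + intVec k))
    have h3 := abs_le.1 (hUB 0)
    have h4 := abs_le.1 (hWB 0)
    have h5 : D ≤ κ * ‖x' + intVec k - (y' + intVec k)‖ ^ 2 := by
      have : 1 ≤ D := by simp only [D]; linarith
      nlinarith
    simp only [D] at h5
    nlinarith

/-- Doubling of variables. A subsolution and a supersolution are tested with the same gradient `P`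
at nearby points `x`, `y` such that `U x - W y ≥ sup (U - W)`, and `‖P‖ ‖x - y‖` is small. -/
theorem exists_doubling {U W : Euc n → ℝ} (hUp : TorusPeriodic U) (hWp : TorusPeriodic W)
    (hU : UpperSemicontinuous U) (hW : LowerSemicontinuous W) {B : ℝ} (hUB : ∀ x, |U x| ≤ B)
    (hWB : ∀ x, |W x| ≤ B) {F G : ℝ → Euc n → Euc n → ℝ} (hF : IsSubsol F U)
    (hG : IsSupersol G W) {ε : ℝ} (hε : 0 < ε) :
    ∃ x y P : Euc n, ‖x - y‖ ≤ ε ∧ ‖P‖ * ‖x - y‖ ≤ ε ∧ (∀ z, U z - W z ≤ U x - W y) ∧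
      F (U x) P x ≤ 0 ∧ 0 ≤ G (W y) P y := by
  have hκ : ∀ k : ℕ, (1 : ℝ) ≤ 2 ^ k := fun k => one_le_pow₀ (by norm_num)
  choose X Y hXY using fun k : ℕ => exists_max_doubled hUp hWp hU hW hUB hWB (hκ k)
  set m : ℕ → ℝ := fun k => U (X k) - W (Y k) - 2 ^ k * ‖X k - Y k‖ ^ 2 with hm
  set δ : ℝ := min (ε ^ 2) (ε / 4) with hδ
  have hδ0 : 0 < δ := by positivity
  -- The maxima `m k` decrease by at least `2 ^ k * ‖X (k + 1) - Y (k + 1)‖ ^ 2`, but are bounded.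
  obtain ⟨k, hk⟩ : ∃ k, 2 ^ k * ‖X (k + 1) - Y (k + 1)‖ ^ 2 ≤ δ := by
    by_contra! hcon
    have hdec : ∀ k, m k ≤ m 0 - k * δ := by
      intro k
      induction k with
      | zero => simp
      | succ k ih =>
        have h1 := hXY k (X (k + 1)) (Y (k + 1))
        have h2 := hcon k
        have h3 : m (k + 1) = U (X (k + 1)) - W (Y (k + 1))
          - 2 ^ k * ‖X (k + 1) - Y (k + 1)‖ ^ 2 - 2 ^ k * ‖X (k + 1) - Y (k + 1)‖ ^ 2 := by
          simp only [hm]; ring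
        push_cast
        simp only [hm] at *
        linarith
    obtain ⟨k, hk⟩ := exists_nat_gt ((m 0 + 2 * B) / δ)
    rw [div_lt_iff₀ hδ0] at hk
    have h1 := hdec k
    have h2 := hXY k 0 0
    have h3 := abs_le.1 (hUB 0)
    have h4 := abs_le.1 (hWB 0)
    simp only [sub_zero, norm_zero, hm] at *
    nlinarith
  set x := X (k + 1)
  set y := Y (k + 1)
  set κ : ℝ := 2 ^ (k + 1) with hκdef
  have hmax := hXY (k + 1)
  have hn := norm_nonneg (x - y)
  have hκn : κ * ‖x - y‖ ^ 2 ≤ ε / 2 := by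
    have : δ ≤ ε / 4 := min_le_right _ _
    rw [hκdef, pow_succ]; linarith
  refine ⟨x, y, (2 * κ) • (x - y), ?_, ?_, fun z => ?_, ?_, ?_⟩
  · have h1 : ‖x - y‖ ^ 2 ≤ ε ^ 2 := by
      have := hκ k
      have h3 : δ ≤ ε ^ 2 := min_le_left _ _
      nlinarith [sq_nonneg ‖x - y‖]
    exact (le_abs_self _).trans (abs_le_of_sq_le_sq h1 hε.le)
  · rw [norm_smul, Real.norm_of_nonneg (by positivity)]
    nlinarith
  · have := hmax z z
    have h2 : 0 ≤ κ * ‖x - y‖ ^ 2 := by positivity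
    simp only [sub_self, norm_zero] at this
    simp only [x, y, κ] at *
    linarith
  · refine hF.apply (contDiff_const_mul_norm_sub_sq κ y)
      (hasGradientAt_const_mul_norm_sub_sq κ y x) fun x' => ?_
    have := hmax x' y
    simp only [x, y, κ] at *
    linarith
  · have hgr := hasGradientAt_const_mul_norm_sub_sq (-κ) x y
    rw [show (2 * -κ) • (y - x) = (2 * κ) • (x - y) by
      rw [← neg_sub x y, smul_neg, mul_neg, neg_smul, neg_neg]] at hgr
    refine hG.apply (contDiff_const_mul_norm_sub_sq (-κ) x) hgr fun y' => ?_
    have := hmax x y'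
    rw [norm_sub_rev y x, norm_sub_rev y' x]
    simp only [x, y, κ] at *
    linarith

end Doubling

/-! ### Perron's method for the discounted equation -/

section Perron
variable {n : ℕ}

/-- A bounded function has an upper semicontinuous envelope. -/
lemma exists_usc_envelope {u : Euc n → ℝ} {B : ℝ} (hB : ∀ x, |u x| ≤ B) :
    ∃ U : Euc n → ℝ, UpperSemicontinuous U ∧ (∀ x, u x ≤ U x) ∧ (∀ x, |U x| ≤ B) ∧
      (TorusPeriodic u → TorusPeriodic U) ∧
      ∀ x, ∀ ε : ℝ, 0 < ε → ∃ y, ‖y - x‖ ≤ ε ∧ U x - ε ≤ u y := by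
  have hbd : ∀ x, (𝓝 x).IsBoundedUnder (· ≤ ·) u := fun x =>
    isBoundedUnder_of ⟨B, fun y => (abs_le.1 (hB y)).2⟩
  have hbd' : ∀ x, (𝓝 x).IsBoundedUnder (· ≥ ·) u := fun x =>
    isBoundedUnder_of ⟨-B, fun y => (abs_le.1 (hB y)).1⟩
  have hcob : ∀ x, (𝓝 x).IsCoboundedUnder (· ≤ ·) u := fun x => (hbd' x).isCoboundedUnder_le
  have hle : ∀ x, u x ≤ limsup u (𝓝 x) := by
    intro x
    by_contra! hlt
    exact lt_irrefl _ (eventually_lt_of_limsup_lt hlt (hbd x)).self_of_nhds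
  refine ⟨fun x => limsup u (𝓝 x), ?_, hle, fun x => ?_, fun hp x k => ?_, fun x ε hε => ?_⟩
  · intro x c hc
    obtain ⟨c', h1, h2⟩ := exists_between hc
    filter_upwards [(eventually_lt_of_limsup_lt h1 (hbd x)).eventually_nhds] with y hy
    exact (limsup_le_of_le (hcob y) (hy.mono fun _ h => h.le)).trans_lt h2
  · refine abs_le.2 ⟨(abs_le.1 (hB x)).1.trans (hle x), ?_⟩
    exact limsup_le_of_le (hcob x) (Eventually.of_forall fun y => (abs_le.1 (hB y)).2)
  · change limsup u (𝓝 (x + intVec k)) = limsup u (𝓝 x)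
    rw [← map_add_right_nhds, limsup, Filter.map_map]
    congr 2
    ext y
    exact hp y k
  · have h1 := frequently_lt_of_lt_limsup (hcob x) (sub_lt_self (limsup u (𝓝 x)) hε)
    obtain ⟨y, hy, hy'⟩ := (h1.and_eventually (Metric.closedBall_mem_nhds x hε)).exists
    exact ⟨y, by simpa [dist_eq_norm] using hy', hy.le⟩

lemma IsSubsol.translate {F : ℝ → Euc n → Euc n → ℝ} {u : Euc n → ℝ} (hu : IsSubsol F u)
    (a : Euc n) (hF : ∀ r P x, F r P (x + a) = F r P x) : IsSubsol F (fun x => u (x + a)) := by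
  intro φ hφ x₀ hmax
  have hg : HasGradientAt (fun x => φ (x + -a)) (gradient φ x₀) (x₀ + a) := by
    have h1 := (hφ.hasGradientAt x₀)
    rw [hasGradientAt_iff_hasFDerivAt] at *
    rw [show x₀ = (x₀ + a) + -a by abel] at h1
    simpa using (hasFDerivAt_comp_add_right (-a)).2 h1
  have := hu.apply (hφ.comp (contDiff_id.add contDiff_const)) hg (fun x => by
    have := hmax (x + -a)
    simpa using this)
  rwa [hF] at this

lemma IsSubsol.sup {F : ℝ → Euc n → Euc n → ℝ} {u v : Euc n → ℝ} (hu : IsSubsol F u)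
    (hv : IsSubsol F v) : IsSubsol F (fun x => max (u x) (v x)) := by
  intro φ hφ x₀ hmax
  rcases le_total (u x₀) (v x₀) with h | h
  · simp only [max_eq_right h] at hmax ⊢
    exact hv φ hφ x₀ fun x => (sub_le_sub_right (le_max_right _ _) _).trans (hmax x)
  · simp only [max_eq_left h] at hmax ⊢
    exact hu φ hφ x₀ fun x => (sub_le_sub_right (le_max_left _ _) _).trans (hmax x)

lemma gradient_eq_zero_of_isMin {φ : Euc n → ℝ} {x₀ : Euc n} (h : ∀ x, φ x₀ ≤ φ x) :
    gradient φ x₀ = 0 := by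
  have : IsLocalMin φ x₀ := Eventually.of_forall h
  simp [gradient, this.fderiv_eq_zero]

lemma gradient_eq_zero_of_isMax {φ : Euc n → ℝ} {x₀ : Euc n} (h : ∀ x, φ x ≤ φ x₀) :
    gradient φ x₀ = 0 := by
  have : IsLocalMax φ x₀ := Eventually.of_forall h
  simp [gradient, this.fderiv_eq_zero]

/-- If `φ` touches `u` from below at `x₀` (`u` being the supremum of the family `S` of
subsolutions) and violates the supersolution inequality there, then some member of `S`, glued with
`φ + δ - ‖x - x₀‖²`, is a subsolution exceeding `u` at `x₀`. -/
lemma exists_bump {F : ℝ → Euc n → Euc n → ℝ}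
    (hF : Continuous fun q : ℝ × Euc n × Euc n => F q.1 q.2.1 q.2.2) {B : ℝ}
    {S : Set (Euc n → ℝ)} (hSc : ∀ w ∈ S, Continuous w) (hSs : ∀ w ∈ S, IsSubsol F w)
    (hSB : ∀ w ∈ S, ∀ x, |w x| ≤ B) (hSm : ∀ w ∈ S, ∀ v ∈ S, (fun x => max (w x) (v x)) ∈ S)
    (hS : S.Nonempty) {u : Euc n → ℝ} (huB : ∀ x, |u x| ≤ B)
    (hu : ∀ x c, c < u x → ∃ w ∈ S, c < w x)
    {φ : Euc n → ℝ} (hφ : ContDiff ℝ 1 φ) {x₀ : Euc n} (hmin : ∀ x, u x₀ - φ x₀ ≤ u x - φ x)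
    (huK : u x₀ < B) (hlt : F (u x₀) (gradient φ x₀) x₀ < 0) :
    ∃ w, Continuous w ∧ IsSubsol F w ∧ (∀ x, |w x| ≤ B) ∧ u x₀ < w x₀ := by
  have hB : 0 ≤ B := (abs_nonneg _).trans (huB x₀)
  set ψ : ℝ → Euc n → ℝ := fun δ x => (φ x + (-1) * ‖x - x₀‖ ^ 2) + (u x₀ - φ x₀ + δ) with hψ
  have hψC : ∀ δ, ContDiff ℝ 1 (ψ δ) := fun δ =>
    (hφ.add (contDiff_const_mul_norm_sub_sq (-1) x₀)).add contDiff_const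
  set Q : Euc n → Euc n := fun x => gradient φ x + (2 * (-1) : ℝ) • (x - x₀) with hQ
  have hψg : ∀ δ x, HasGradientAt (ψ δ) (Q x) x := by
    intro δ x
    have := (hφ.hasGradientAt x).add_fun (hasGradientAt_const_mul_norm_sub_sq (-1) x₀ x)
    rw [hasGradientAt_iff_hasFDerivAt] at *
    exact this.add_const _
  have hφc := hφ.continuous
  have hQc : Continuous Q := (continuous_gradient hφ).add (by fun_prop)
  have hψc : Continuous fun q : ℝ × Euc n => ψ q.1 q.2 := by
    simp only [hψ]; fun_prop
  have hnear : ∀ᶠ q : ℝ × Euc n in 𝓝 (0, x₀), F (ψ q.1 q.2) (Q q.2) q.2 < 0 ∧ ψ q.1 q.2 < B := by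
    refine ContinuousAt.eventually_lt ?_ continuousAt_const ?_ |>.and
      (ContinuousAt.eventually_lt hψc.continuousAt continuousAt_const ?_)
    · exact (hF.comp (hψc.prodMk ((hQc.comp continuous_snd).prodMk continuous_snd))).continuousAt
    · simpa [hψ, hQ] using hlt
    · simpa [hψ] using huK
  obtain ⟨r, hr, hball⟩ := Metric.eventually_nhds_iff_ball.1 hnear
  set ρ : ℝ := min r 1 / 2 with hρ
  have hρ0 : 0 < ρ := by positivity
  have hρr : ρ < r := by
    have := min_le_left r 1
    simp only [hρ]; linarith
  have hρ1 : ρ ≤ 1 / 2 := by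
    have := min_le_right r 1
    simp only [hρ]; linarith
  set δ : ℝ := ρ ^ 2 / 2 with hδ
  have hδ0 : 0 < δ := by positivity
  have hδr : δ < r := by nlinarith
  have hin : ∀ x, ‖x - x₀‖ < r → F (ψ δ x) (Q x) x < 0 ∧ ψ δ x < B := fun x hx => by
    refine hball (δ, x) ?_
    rw [← ball_prod_same]
    exact ⟨by simpa [abs_of_pos hδ0] using hδr, by simpa [dist_eq_norm] using hx⟩
  have hout : ∀ x, ρ ≤ ‖x - x₀‖ → ψ δ x < u x := fun x hx => by
    have h1 := hmin x
    have h2 : ρ ^ 2 ≤ ‖x - x₀‖ ^ 2 := by gcongr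
    simp only [hψ, hδ]; nlinarith
  -- One member of the family is above the bump on the compact annulus `A`.
  set R : ℝ := 2 * B + 1
  set A : Set (Euc n) := Metric.closedBall x₀ R \ Metric.ball x₀ ρ
  have hA : IsCompact A := (isCompact_closedBall x₀ R).diff Metric.isOpen_ball
  have : Nonempty S := hS.to_subtype
  obtain ⟨⟨v, hvS⟩, hv⟩ := hA.elim_directed_cover (fun w : S => {x | ψ δ x < w.1 x})
    (fun w => isOpen_lt (hψC δ).continuous (hSc _ w.2))
    (fun x hx => by
      have : ρ ≤ ‖x - x₀‖ := by simpa [dist_eq_norm] using hx.2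
      obtain ⟨w, hw, hwx⟩ := hu x _ (hout x this)
      exact Set.mem_iUnion.2 ⟨⟨w, hw⟩, hwx⟩)
    (fun w v => ⟨⟨_, hSm _ w.2 _ v.2⟩, fun x (hx : ψ δ x < w.1 x) => lt_max_of_lt_left hx,
      fun x (hx : ψ δ x < v.1 x) => lt_max_of_lt_right hx⟩)
  have hvout : ∀ x, ρ ≤ ‖x - x₀‖ → ψ δ x < v x := fun x hx => by
    by_cases hxR : ‖x - x₀‖ ≤ R
    · exact hv ⟨by simpa [dist_eq_norm] using hxR, by simpa [dist_eq_norm] using hx⟩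
    · push Not at hxR
      have h1 := hmin x
      have h2 := abs_le.1 (huB x)
      have h3 := abs_le.1 (hSB v hvS x)
      have h4 : 2 * B + 1 ≤ ‖x - x₀‖ ^ 2 := by
        simp only [R] at hxR; nlinarith
      simp only [hψ]; nlinarith
  refine ⟨fun x => max (v x) (ψ δ x), (hSc v hvS).max (hψC δ).continuous, ?_, fun x => ?_, ?_⟩
  · intro φ' hφ' y hmax
    rcases le_or_gt (ψ δ y) (v y) with h | h
    · simp only [max_eq_left h] at hmax ⊢
      exact hSs v hvS φ' hφ' y fun x => (sub_le_sub_right (le_max_left _ _) _).trans (hmax x)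
    · simp only [max_eq_right h.le] at hmax ⊢
      have hy : ‖y - x₀‖ < ρ := by
        by_contra! hcon
        exact lt_irrefl _ (h.trans (hvout y hcon))
      have hgr : gradient φ' y - Q y = 0 := by
        have h1 : gradient (fun x => φ' x + - ψ δ x) y = 0 := gradient_eq_zero_of_isMin fun x => by
          have h2 := hmax x
          have h3 := le_max_right (v x) (ψ δ x)
          linarith
        rw [((hφ'.hasGradientAt y).add_fun (hψg δ y).neg_fun).gradient] at h1
        rw [sub_eq_add_neg, h1]
      rw [sub_eq_zero.1 hgr]
      exact (hin y (hy.trans hρr)).1.le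
  · have h1 := abs_le.1 (hSB v hvS x)
    refine abs_le.2 ⟨h1.1.trans (le_max_left _ _), max_le h1.2 ?_⟩
    by_cases hx : ρ ≤ ‖x - x₀‖
    · exact (hvout x hx).le.trans h1.2
    · exact (hin x ((not_le.1 hx).trans hρr)).2.le
  · refine lt_max_of_lt_right ?_
    simp only [hψ, sub_self, norm_zero]; linarith

/-- Perron's method: the discounted equation `l u + H(Du, x) = 0` has a continuous periodic
viscosity solution. -/
theorem exists_discounted_solution {H : Euc n → Euc n → ℝ}
    (hH : Continuous fun q : Euc n × Euc n => H q.1 q.2) (hHp : ∀ P, TorusPeriodic (H P)) {C : ℝ}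
    (hC : 0 ≤ C)
    (hHC : ∀ P x y, |H P x - H P y| ≤ C * (1 + ‖P‖) * ‖x - y‖) {K : ℝ} (hK : ∀ x, |H 0 x| ≤ K)
    {l : ℝ} (hl : 0 < l) :
    ∃ u : Euc n → ℝ, Continuous u ∧ TorusPeriodic u ∧ (∀ x, |l * u x| ≤ K) ∧
      IsSubsol (fun r P x => l * r + H P x) u ∧ IsSupersol (fun r P x => l * r + H P x) u := by
  set F : ℝ → Euc n → Euc n → ℝ := fun r P x => l * r + H P x with hFdef
  have hF : Continuous fun q : ℝ × Euc n × Euc n => F q.1 q.2.1 q.2.2 :=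
    (continuous_const.mul continuous_fst).add (hH.comp continuous_snd)
  have hFp : ∀ (k : Fin n → ℤ) r P x, F r P (x + intVec k) = F r P x := fun k r P x => by
    simp only [hFdef, (hHp P).add_intVec x k]
  set B : ℝ := K / l with hBdef
  have hlB : l * B = K := by simp only [hBdef]; field_simp
  have hK0 : 0 ≤ K := (abs_nonneg _).trans (hK 0)
  have hB : 0 ≤ B := by positivity
  set S : Set (Euc n → ℝ) := {w | Continuous w ∧ IsSubsol F w ∧ ∀ x, |w x| ≤ B} with hSdef
  have hconst : (fun _ => -B) ∈ S := by
    refine ⟨continuous_const, fun φ hφ x₀ hmax => ?_, fun x => by simp [abs_of_nonneg hB]⟩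
    have h1 : gradient φ x₀ = 0 := gradient_eq_zero_of_isMin fun x => by
      have := hmax x; linarith
    have h2 := abs_le.1 (hK x₀)
    simp only [hFdef, h1]
    linarith
  have hSne : S.Nonempty := ⟨_, hconst⟩
  have : Nonempty S := hSne.to_subtype
  set u : Euc n → ℝ := fun x => ⨆ w : S, w.1 x with hu
  have hbdd : ∀ x, BddAbove (Set.range fun w : S => w.1 x) := fun x =>
    ⟨B, by rintro _ ⟨w, rfl⟩; exact (abs_le.1 (w.2.2.2 x)).2⟩
  have hwu : ∀ w ∈ S, ∀ x, w x ≤ u x := fun w hw x => le_ciSup (hbdd x) ⟨w, hw⟩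
  have huB : ∀ x, |u x| ≤ B := fun x => abs_le.2 ⟨hwu _ hconst x,
    ciSup_le fun w => (abs_le.1 (w.2.2.2 x)).2⟩
  have hucl : ∀ x c, c < u x → ∃ w ∈ S, c < w x := fun x c hc => by
    obtain ⟨w, hw⟩ := exists_lt_of_lt_ciSup hc
    exact ⟨w.1, w.2, hw⟩
  have hup' : ∀ x (k : Fin n → ℤ), u (x + intVec k) ≤ u x := fun x k => by
    refine ciSup_le fun w => ?_
    exact hwu (fun x => w.1 (x + intVec k)) ⟨w.2.1.comp (by fun_prop),
      w.2.2.1.translate _ (hFp k), fun x => w.2.2.2 _⟩ x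
  have hup : TorusPeriodic u := fun x k => by
    refine le_antisymm (hup' x k) ?_
    have := hup' (x + intVec k) (-k)
    rwa [intVec_neg, add_neg_cancel_right] at this
  have hlsc : LowerSemicontinuous u :=
    lowerSemicontinuous_ciSup hbdd fun w => w.2.1.lowerSemicontinuous
  have hsuper : IsSupersol F u := by
    intro φ hφ x₀ hmin
    by_contra! hlt
    rcases lt_or_ge (u x₀) B with huK | huK
    · obtain ⟨w, hwc, hws, hwB, hw⟩ := exists_bump hF (fun w (hw : w ∈ S) => hw.1)
        (fun w hw => hw.2.1) (fun w hw => hw.2.2)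
        (fun w hw v hv => ⟨hw.1.max hv.1, hw.2.1.sup hv.2.1, fun x =>
          abs_le.2 ⟨(abs_le.1 (hw.2.2 x)).1.trans (le_max_left _ _),
            max_le (abs_le.1 (hw.2.2 x)).2 (abs_le.1 (hv.2.2 x)).2⟩⟩)
        hSne huB hucl hφ hmin huK hlt
      exact lt_irrefl _ (hw.trans_le (hwu w ⟨hwc, hws, hwB⟩ x₀))
    · have h1 : gradient φ x₀ = 0 := gradient_eq_zero_of_isMax fun x => by
        have := hmin x
        have := (abs_le.1 (huB x)).2
        linarith
      have h2 := abs_le.1 (hK x₀)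
      simp only [hFdef, h1] at hlt
      nlinarith
  obtain ⟨U, hUusc, huU, hUB, hUp, hUapp⟩ := exists_usc_envelope huB
  have hsub : IsSubsol F U := by
    intro φ hφ x₀ hmax
    refine subsol_test_of_approx hF hφ hmax fun ε hε => ?_
    obtain ⟨y, hy, hUy⟩ := hUapp x₀ (ε / 2) (by positivity)
    obtain ⟨w, hw, hwy⟩ := hucl y (u y - ε / 2) (by linarith)
    refine ⟨w, hw.1, hw.2.1.mono fun P x => by linarith, fun x => ?_, y, by linarith, by linarith⟩
    have := hwu w hw x
    have := huU x
    linarith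
  have hUu : ∀ z, U z ≤ u z := by
    intro z
    have key : ∀ ε : ℝ, 0 < ε → U z - u z ≤ 2 * C / l * ε := by
      intro ε hε
      obtain ⟨x, y, P, hxy, hPxy, hz, h1, h2⟩ :=
        exists_doubling (hUp hup) hup hUusc hlsc hUB huB hsub hsuper hε
      have h3 := (abs_le.1 (hHC P x y)).1
      have h4 : C * (1 + ‖P‖) * ‖x - y‖ ≤ 2 * C * ε := by
        have : (1 + ‖P‖) * ‖x - y‖ ≤ 2 * ε := by linarith
        nlinarith
      have h5 := hz z
      simp only [hFdef] at h1 h2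
      rw [div_mul_eq_mul_div, le_div_iff₀ hl]
      nlinarith
    have h0 : Tendsto (fun ε : ℝ => 2 * C / l * ε) (𝓝[>] 0) (𝓝 (2 * C / l * 0)) :=
      (tendsto_id.const_mul _).mono_left nhdsWithin_le_nhds
    have := ge_of_tendsto h0 (eventually_mem_nhdsWithin.mono fun ε hε => key ε hε)
    linarith
  have hUeq : U = u := funext fun z => le_antisymm (hUu z) (huU z)
  rw [hUeq] at hUusc hsub
  refine ⟨u, continuous_iff_lower_upperSemicontinuous.2 ⟨hlsc, hUusc⟩, hup, fun x => ?_, hsub,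
    hsuper⟩
  rw [abs_mul, abs_of_pos hl, ← hlB]
  exact mul_le_mul_of_nonneg_left (huB x) hl.le

end Perron

/-! ### Propagation of upper bounds along the drift -/

section Propagation
variable {n : ℕ}

lemma hasDerivAt_max_zero_sq (s : ℝ) :
    HasDerivAt (fun s : ℝ => max s 0 ^ 2) (2 * max s 0) s := by
  rcases lt_trichotomy s 0 with hs | rfl | hs
  · rw [max_eq_right hs.le, mul_zero]
    refine (hasDerivAt_const s (0 : ℝ)).congr_of_eventuallyEq ?_
    filter_upwards [eventually_lt_nhds hs] with t ht
    simp [max_eq_right ht.le]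
  · have h : (fun s : ℝ => max s 0 ^ 2) =O[𝓝 0] fun s => ‖s - 0‖ ^ 2 := by
      refine Asymptotics.IsBigO.of_bound 1 (Eventually.of_forall fun t => ?_)
      have : max t 0 ≤ |t| := max_le (le_abs_self t) (abs_nonneg t)
      simp only [Real.norm_eq_abs, abs_pow, sub_zero, abs_abs, one_mul]
      rw [abs_of_nonneg (le_max_right t 0)]
      gcongr
    have := (h.hasFDerivAt (by norm_num)).hasDerivAt
    simpa using this
  · rw [max_eq_left hs.le]
    have := hasDerivAt_pow 2 s
    refine (by simpa using this :
      HasDerivAt (fun s : ℝ => s ^ 2) (2 * s) s).congr_of_eventuallyEq ?_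
    filter_upwards [eventually_gt_nhds hs] with t ht
    simp [max_eq_left ht.le]

lemma contDiff_max_zero_sq : ContDiff ℝ 1 (fun s : ℝ => max s 0 ^ 2) := by
  rw [contDiff_one_iff_deriv]
  refine ⟨fun s => (hasDerivAt_max_zero_sq s).differentiableAt, ?_⟩
  rw [show deriv (fun s : ℝ => max s 0 ^ 2) = fun s => 2 * max s 0 from
    funext fun s => (hasDerivAt_max_zero_sq s).deriv]
  fun_prop

lemma HasDerivAt.nonneg_of_isMax_left {f : ℝ → ℝ} {d t₀ : ℝ} (hf : HasDerivAt f d t₀)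
    (ht₀ : 0 < t₀) (hmax : ∀ t, 0 ≤ t → t ≤ t₀ → f t ≤ f t₀) : 0 ≤ d := by
  have h := hf.tendsto_slope.mono_left
    (nhdsWithin_mono t₀ (fun t (ht : t < t₀) => ht.ne) : 𝓝[<] t₀ ≤ 𝓝[≠] t₀)
  refine ge_of_tendsto h ?_
  filter_upwards [Ioo_mem_nhdsLT ht₀] with t ht
  rw [slope_def_field]
  exact div_nonneg_of_nonpos (by linarith [hmax t ht.1.le ht.2.le]) (by linarith [ht.2])

/-- Upper bounds for a subsolution `u` of `‖Du‖ + b · Du ≤ K` propagate: a bound on a ball gives a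
bound, deteriorating at rate `K`, on the ball which moves with a velocity `b₀` close to `b` while
its radius grows with speed `1/2`. -/
theorem IsSubsol.le_on_moving_ball {b : Euc n → Euc n} {u : Euc n → ℝ} {K B : ℝ}
    (hu : Continuous u) (huB : ∀ x, |u x| ≤ B)
    (hsub : IsSubsol (fun _ P x => ‖P‖ + ⟪b x, P⟫ - K) u) (hK : 0 ≤ K) {x b₀ : Euc n}
    {r η h m : ℝ} (hr : 0 ≤ r) (hη : 0 < η) (hh : 0 ≤ h)
    (hb : ∀ z, ‖z - x‖ ≤ h * ‖b₀‖ + r + h / 2 + η → ‖b z - b₀‖ ≤ 1 / 2)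
    (hm : ∀ z, ‖z - x‖ ≤ r + η → u z ≤ m) :
    ∀ z, ‖z - (x + h • b₀)‖ ≤ r + h / 2 → u z ≤ m + K * h := by
  intro z₁ hz₁
  have hB : 0 ≤ B := (abs_nonneg _).trans (huB x)
  refine le_of_forall_pos_le_add fun ε hε => ?_
  -- The strict rate `K' > K` gives the contradiction at positive times.
  obtain ⟨K', hK', hK'ε⟩ : ∃ K', K < K' ∧ K' * h ≤ K * h + ε := by
    refine ⟨K + ε / (h + 1), by have : 0 < ε / (h + 1) := by positivity
                                linarith, ?_⟩
    have : ε / (h + 1) * h ≤ ε := by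
      rw [div_mul_eq_mul_div, div_le_iff₀ (by positivity)]; nlinarith
    linarith
  set N : ℝ := (2 * B + 1) / η ^ 4 with hN
  have hN0 : 0 < N := by positivity
  have hNη : N * (η ^ 2) ^ 2 = 2 * B + 1 := by simp only [hN]; field_simp
  set y : Euc n → ℝ → Euc n := fun z t => z - (x + t • b₀) with hy
  set q : Euc n → ℝ → ℝ := fun z t => ‖y z t‖ ^ 2 - (r + t / 2) ^ 2 with hq
  set G : Euc n → ℝ → ℝ := fun z t => N * max (q z t) 0 ^ 2 with hG
  have hG0 : ∀ z t, 0 ≤ G z t := fun z t => by positivity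
  have hGbig : ∀ z t, 0 ≤ t → r + t / 2 + η ≤ ‖y z t‖ → 2 * B + 1 ≤ G z t := by
    intro z t ht hyz
    have h1 : η ^ 2 ≤ q z t := by
      simp only [hq]
      have : 0 ≤ r + t / 2 := by positivity
      nlinarith
    rw [← hNη]
    have h2 : η ^ 2 ≤ max (q z t) 0 := h1.trans (le_max_left _ _)
    simp only [hG]
    gcongr
  set R : ℝ := h * ‖b₀‖ + r + h / 2 + η with hR
  have hR0 : 0 ≤ R := by positivity
  have hyR : ∀ z t, 0 ≤ t → t ≤ h → ‖y z t‖ ≤ r + t / 2 + η → ‖z - x‖ ≤ R := by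
    intro z t ht hth hyz
    have h1 : z - x = y z t + t • b₀ := by simp only [hy]; abel
    have h2 : ‖t • b₀‖ ≤ h * ‖b₀‖ := by
      rw [norm_smul, Real.norm_of_nonneg ht]; gcongr
    rw [h1]
    refine (norm_add_le _ _).trans ?_
    simp only [hR]; linarith
  set f : Euc n × ℝ → ℝ := fun p => u p.1 - K' * p.2 - G p.1 p.2 with hf
  have hfc : Continuous f := by
    simp only [hf, hG, hq, hy]; fun_prop
  obtain ⟨⟨z₀, t₀⟩, hmem, hmax⟩ :=
    ((isCompact_closedBall x R).prod (isCompact_Icc (a := (0 : ℝ)) (b := h))).exists_isMaxOn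
      ⟨(x, 0), by simp [hR0], by simp [hh]⟩ hfc.continuousOn
  have ht₀ : 0 ≤ t₀ ∧ t₀ ≤ h := hmem.2
  have hfx : -B ≤ f (x, 0) := by
    have h1 : q x 0 ≤ 0 := by simp [hq, hy]; positivity
    have h2 := (abs_le.1 (huB x)).1
    simp only [hf, hG, max_eq_right h1]; linarith
  have hmaxx : f (x, 0) ≤ f (z₀, t₀) := hmax ⟨by simp [hR0], by simp [hh]⟩
  have hout : ∀ z t, 0 ≤ t → r + t / 2 + η ≤ ‖y z t‖ → f (z, t) < f (x, 0) := by
    intro z t ht hyz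
    have h1 := hGbig z t ht hyz
    have h2 := (abs_le.1 (huB z)).2
    have h3 : 0 ≤ K' * t := by have := hK.trans hK'.le; positivity
    simp only [hf] at *; linarith
  have hmax' : ∀ z t, 0 ≤ t → t ≤ h → f (z, t) ≤ f (z₀, t₀) := by
    intro z t ht hth
    rcases le_total (r + t / 2 + η) ‖y z t‖ with hyz | hyz
    · exact (hout z t ht hyz).le.trans hmaxx
    · exact hmax ⟨by simpa [dist_eq_norm] using hyR z t ht hth hyz, ht, hth⟩
  have hy₀ : ‖y z₀ t₀‖ < r + t₀ / 2 + η := by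
    by_contra! hcon
    exact absurd hmaxx (not_le.2 (hout z₀ t₀ ht₀.1 hcon))
  rcases ht₀.1.eq_or_lt with ht | ht
  · -- The maximum is at time zero, where the bound holds by assumption.
    have h1 := hmax' z₁ h hh le_rfl
    have h2 : q z₁ h ≤ 0 := by
      simp only [hq, sub_nonpos]
      gcongr
    have h3 : u z₀ ≤ m := hm z₀ (by
      have := hy₀.le
      rw [← ht] at this
      simpa [hy] using this)
    have h4 := hG0 z₀ t₀
    have h5 : G z₁ h = 0 := by simp [hG, max_eq_right h2]
    simp only [hf, h5] at h1
    rw [← ht] at h1 h4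
    linarith
  · exfalso
    set γ : ℝ := N * (2 * max (q z₀ t₀) 0) with hγ
    have hγ0 : 0 ≤ γ := by positivity
    -- gradient in space
    have hsp : ‖(γ * 2) • y z₀ t₀‖ + ⟪b z₀, (γ * 2) • y z₀ t₀⟫ - K ≤ 0 := by
      have hGc : ContDiff ℝ 1 fun z => G z t₀ :=
        contDiff_const.mul (contDiff_max_zero_sq.comp
          (((contDiff_id.sub contDiff_const).norm_sq ℝ).sub contDiff_const))
      refine hsub.apply hGc (P := (γ * 2) • y z₀ t₀) ?_ fun z => ?_
      · have h1 := hasGradientAt_const_mul_norm_sub_sq 1 (x + t₀ • b₀) z₀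
        rw [hasGradientAt_iff_hasFDerivAt] at *
        have h2 : HasFDerivAt (fun z => q z t₀)
            (InnerProductSpace.toDual ℝ (Euc n) ((2 * 1 : ℝ) • (z₀ - (x + t₀ • b₀)))) z₀ := by
          simpa only [one_mul] using h1.sub_const ((r + t₀ / 2) ^ 2)
        have h3 := ((hasDerivAt_max_zero_sq (q z₀ t₀)).comp_hasFDerivAt z₀ h2).const_mul N
        refine h3.congr_fderiv ?_
        simp only [hγ, ← map_smul]
        congr 1
        simp only [smul_smul, hy]
        congr 1; ring
      · have := hmax' z t₀ ht₀.1 ht₀.2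
        simp only [hf] at this; linarith
    -- derivative in time
    have htime : 0 ≤ -K' + γ * (2 * ⟪y z₀ t₀, b₀⟫ + (r + t₀ / 2)) := by
      have hy' : HasDerivAt (fun t => y z₀ t) (-b₀) t₀ := by
        have := (((hasDerivAt_id t₀).smul_const b₀).const_add x).const_sub z₀
        simpa [hy] using this
      have hq' : HasDerivAt (fun t => q z₀ t)
          (2 * ⟪y z₀ t₀, -b₀⟫ - 2 * (r + t₀ / 2) * (1 / 2)) t₀ := by
        have h1 := hy'.norm_sq
        have h2 := (((hasDerivAt_id t₀).div_const 2).const_add r).pow 2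
        have h3 := h1.sub h2
        refine h3.congr_deriv ?_
        simp only [id]
        ring
      have hG' := ((hasDerivAt_max_zero_sq (q z₀ t₀)).comp t₀ hq').const_mul N
      have hf' := ((hasDerivAt_id t₀).const_mul (-K')).sub hG'
      have := hf'.nonneg_of_isMax_left ht fun t h0 h1 => by
        have := hmax' z₀ t h0 (h1.trans ht₀.2)
        simp only [hf, hG] at this
        simp only [Pi.sub_apply, Function.comp_apply, id]
        linarith
      refine this.trans_eq ?_
      simp only [hγ, inner_neg_right]
      ring
    have hbz : ‖b z₀ - b₀‖ ≤ 1 / 2 := hb z₀ (hyR z₀ t₀ ht₀.1 ht₀.2 hy₀.le)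
    rw [norm_smul, Real.norm_of_nonneg (by positivity), inner_smul_right] at hsp
    have hinn : ⟪y z₀ t₀, b₀⟫ ≤ ⟪b z₀, y z₀ t₀⟫ + 1 / 2 * ‖y z₀ t₀‖ := by
      have h1 := (abs_le.1 (abs_real_inner_le_norm (b z₀ - b₀) (y z₀ t₀))).1
      rw [inner_sub_left, real_inner_comm (y z₀ t₀) b₀] at h1
      have h2 : ‖b z₀ - b₀‖ * ‖y z₀ t₀‖ ≤ 1 / 2 * ‖y z₀ t₀‖ := by gcongr
      linarith
    have hγy : γ * (r + t₀ / 2) ≤ γ * ‖y z₀ t₀‖ := by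
      rcases le_or_gt (q z₀ t₀) 0 with h0 | h0
      · simp [hγ, max_eq_right h0]
      · have : r + t₀ / 2 ≤ ‖y z₀ t₀‖ := by
          refine le_of_lt (lt_of_pow_lt_pow_left₀ 2 (norm_nonneg _) ?_)
          simpa [hq] using h0
        gcongr
    have := mul_le_mul_of_nonneg_left hinn hγ0
    nlinarith

end Propagation

/-! ### Volumes of periodic sets -/

section Volume
variable {n : ℕ}

/-- The half-open unit cell `[0,1)ⁿ`. -/
def unitCell (n : ℕ) : Set (Euc n) :=
  ZSpan.fundamentalDomain (EuclideanSpace.basisFun (Fin n) ℝ).toBasis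

lemma measurableSet_unitCell : MeasurableSet (unitCell n) :=
  ZSpan.fundamentalDomain_measurableSet _

lemma volume_unitCell_ne_top : volume (unitCell n) ≠ ⊤ :=
  (ZSpan.fundamentalDomain_isBounded _).measure_lt_top.ne

lemma exists_eq_intVec
    (g : Submodule.span ℤ (Set.range (EuclideanSpace.basisFun (Fin n) ℝ).toBasis)) :
    ∃ k : Fin n → ℤ, (g : Euc n) = intVec k := by
  have h := (Module.Basis.mem_span_iff_repr_mem ℤ
    (EuclideanSpace.basisFun (Fin n) ℝ).toBasis (g : Euc n)).1 g.2
  choose k hk using h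
  refine ⟨k, ?_⟩
  ext i
  have := hk i
  simpa using this.symm

lemma intVec_eq_zero_of_norm_lt_one {k : Fin n → ℤ} (h : ‖intVec k‖ < 1) :
    intVec k = 0 := by
  ext i
  have h1 : ‖intVec k i‖ < 1 := (PiLp.norm_apply_le _ i).trans_lt h
  simp only [intVec_apply, Int.norm_cast_real, Int.norm_eq_abs] at h1
  have h2 : |k i| < 1 := by exact_mod_cast h1
  simp [Int.abs_lt_one_iff.1 h2]

/-- A set all of whose integer translates are disjoint has at most the volume, per unit cell, of
any periodic set containing it. -/
lemma volume_le_of_disjoint_translates {t S : Set (Euc n)} (ht : MeasurableSet t)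
    (hd : ∀ k, ∀ x ∈ t, x + intVec k ∈ t → intVec (n := n) k = 0)
    (hS : TorusPeriodic (fun x => x ∈ S)) (hts : t ⊆ S) :
    volume t ≤ volume (S ∩ unitCell n) := by
  have hfd := ZSpan.isAddFundamentalDomain (EuclideanSpace.basisFun (Fin n) ℝ).toBasis
    (volume : Measure (Euc n))
  have : VAddInvariantMeasure
      (Submodule.span ℤ (Set.range (EuclideanSpace.basisFun (Fin n) ℝ).toBasis)) (Euc n) volume :=
    inferInstanceAs (VAddInvariantMeasure (Submodule.span ℤ
      (Set.range (EuclideanSpace.basisFun (Fin n) ℝ).toBasis)).toAddSubgroup (Euc n) volume)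
  rw [hfd.measure_eq_tsum t]
  refine (tsum_meas_le_meas_iUnion_of_disjoint volume (fun g => ?_) ?_).trans
    (measure_mono (Set.iUnion_subset fun g => ?_))
  · exact (ht.const_vadd g).inter measurableSet_unitCell
  · intro g g' hgg'
    rw [Function.onFun, Set.disjoint_left]
    rintro x ⟨hx, -⟩ ⟨hx', -⟩
    rw [Set.mem_vadd_set] at hx hx'
    obtain ⟨y, hy, rfl⟩ := hx
    obtain ⟨y', hy', h⟩ := hx'
    obtain ⟨k, hk⟩ := exists_eq_intVec (g' - g)
    have h1 : (g' : Euc n) + y' = g + y := h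
    have h2 : y = y' + intVec k := by
      rw [← hk]
      push_cast
      rw [← sub_eq_zero]
      rw [← sub_eq_zero] at h1
      rw [← neg_eq_zero, ← h1]; abel
    have h3 := hd k y' hy' (h2 ▸ hy)
    apply hgg'
    rw [h3] at hk
    exact (sub_eq_zero.1 (Subtype.ext hk)).symm
  · rintro x ⟨hx, hxD⟩
    refine ⟨?_, hxD⟩
    obtain ⟨y, hy, rfl⟩ := Set.mem_vadd_set.1 hx
    obtain ⟨k, hk⟩ := exists_eq_intVec g
    have : (g +ᵥ y : Euc n) = y + intVec k := by
      rw [← hk, add_comm]; rfl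
    rw [this]
    exact (hS.add_intVec y k).symm ▸ hts hy

lemma eq_zero_of_mem_unitCell {k : Fin n → ℤ} {x : Euc n} (hx : x ∈ unitCell n)
    (hx' : x + intVec k ∈ unitCell n) : intVec k = 0 := by
  ext i
  rw [unitCell, ZSpan.mem_fundamentalDomain] at hx hx'
  have h1 := hx i
  have h2 := hx' i
  simp only [OrthonormalBasis.coe_toBasis_repr_apply, EuclideanSpace.basisFun_repr,
    PiLp.add_apply, intVec_apply, Set.mem_Ico] at h1 h2
  have h3 : (k i : ℝ) < 1 := by linarith
  have h4 : (-1 : ℝ) < k i := by linarith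
  have h5 : k i = 0 := by
    have h3' : k i < 1 := by exact_mod_cast h3
    have h4' : -1 < k i := by exact_mod_cast h4
    omega
  simp [h5]

/-- An injective map of the torus whose Jacobian is at least `1 - δ` shrinks volumes at most by the
factor `1 - δ`. -/
lemma volume_image_ge {Ψ : Euc n → Euc n} {Ψ' : Euc n → Euc n →L[ℝ] Euc n}
    (hΨ : ∀ x, HasFDerivAt Ψ (Ψ' x) x) (hinj : Function.Injective Ψ)
    (hper : ∀ x (k : Fin n → ℤ), Ψ (x + intVec k) = Ψ x + intVec k) {δ : ℝ}
    (hdet : ∀ x, 1 - δ ≤ |(Ψ' x).det|) {S : Set (Euc n)} (hSm : MeasurableSet S)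
    (hS : TorusPeriodic (fun x => x ∈ S)) :
    MeasurableSet (Ψ '' S) ∧ TorusPeriodic (fun x => x ∈ Ψ '' S) ∧
      ENNReal.ofReal (1 - δ) * volume (S ∩ unitCell n) ≤ volume (Ψ '' S ∩ unitCell n) := by
  have hΨc : Continuous Ψ := continuous_iff_continuousAt.2 fun x => (hΨ x).continuousAt
  have hmeas : ∀ T : Set (Euc n), MeasurableSet T → MeasurableSet (Ψ '' T) := fun T hT =>
    hT.image_of_continuousOn_injOn hΨc.continuousOn hinj.injOn
  have hsub : ∀ x (k : Fin n → ℤ), x ∈ Ψ '' S → x + intVec k ∈ Ψ '' S := by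
    rintro _ k ⟨y, hy, rfl⟩
    exact ⟨y + intVec k, (hS.add_intVec y k).symm ▸ hy, hper y k⟩
  have hperS : TorusPeriodic (fun x => x ∈ Ψ '' S) := fun x k => by
    refine propext ⟨fun h => ?_, hsub x k⟩
    have := hsub _ (-k) h
    rw [intVec_neg] at this
    change x + intVec k + -intVec k ∈ _ at this
    rwa [add_neg_cancel_right] at this
  refine ⟨hmeas S hSm, hperS, ?_⟩
  have hm : MeasurableSet (S ∩ unitCell n) := hSm.inter measurableSet_unitCell
  calc ENNReal.ofReal (1 - δ) * volume (S ∩ unitCell n)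
      = ∫⁻ _ in S ∩ unitCell n, ENNReal.ofReal (1 - δ) := by rw [setLIntegral_const]
    _ ≤ ∫⁻ x in S ∩ unitCell n, ENNReal.ofReal |(Ψ' x).det| :=
        lintegral_mono fun x => ENNReal.ofReal_le_ofReal (hdet x)
    _ = volume (Ψ '' (S ∩ unitCell n)) := lintegral_abs_det_fderiv_eq_addHaar_image volume hm
        (fun x _ => (hΨ x).hasFDerivWithinAt) hinj.injOn
    _ ≤ volume (Ψ '' S ∩ unitCell n) := by
        refine volume_le_of_disjoint_translates (hmeas _ hm) ?_ hperS
          (Set.image_mono Set.inter_subset_left)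
        rintro k _ ⟨y, hy, rfl⟩ ⟨z, hz, hzy⟩
        rw [← hper] at hzy
        rw [hinj hzy] at hz
        exact eq_zero_of_mem_unitCell hy.2 hz.2

lemma volume_iterate_image_ge {Ψ : Euc n → Euc n} {Ψ' : Euc n → Euc n →L[ℝ] Euc n}
    (hΨ : ∀ x, HasFDerivAt Ψ (Ψ' x) x) (hinj : Function.Injective Ψ)
    (hper : ∀ x (k : Fin n → ℤ), Ψ (x + intVec k) = Ψ x + intVec k) {δ : ℝ} (hδ : δ ≤ 1)
    (hdet : ∀ x, 1 - δ ≤ |(Ψ' x).det|) {S : Set (Euc n)} (hSm : MeasurableSet S)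
    (hS : TorusPeriodic (fun x => x ∈ S)) (j : ℕ) :
    MeasurableSet (Ψ^[j] '' S) ∧ TorusPeriodic (fun x => x ∈ Ψ^[j] '' S) ∧
      ENNReal.ofReal ((1 - δ) ^ j) * volume (S ∩ unitCell n) ≤
        volume (Ψ^[j] '' S ∩ unitCell n) := by
  induction j with
  | zero => simpa using ⟨hSm, hS⟩
  | succ j ih =>
    obtain ⟨h1, h2, h3⟩ := ih
    rw [Function.iterate_succ', Set.image_comp]
    obtain ⟨h4, h5, h6⟩ := volume_image_ge hΨ hinj hper hdet h1 h2
    refine ⟨h4, h5, le_trans ?_ h6⟩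
    rw [pow_succ', ENNReal.ofReal_mul (by linarith), mul_assoc]
    gcongr

/-- Enlarging a nonempty periodic set by `ρ` gains the volume of a ball of radius `ρ / 2`, unless
the enlarged set is everything. -/
lemma volume_enlarge_ge {W S : Set (Euc n)} {ρ : ℝ} (hρ : 0 < ρ) (hρ1 : ρ ≤ 1 / 2)
    (hWm : MeasurableSet W)
    (hWne : W.Nonempty) (hWp : TorusPeriodic (fun x => x ∈ W)) (hSm : MeasurableSet S)
    (hSp : TorusPeriodic (fun x => x ∈ S)) (hWS : ∀ w ∈ W, ∀ z, ‖z - w‖ ≤ ρ → z ∈ S)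
    (hS : S ≠ Set.univ) :
    volume (W ∩ unitCell n) + volume (Metric.ball (0 : Euc n) (ρ / 2)) ≤
      volume (S ∩ unitCell n) := by
  have hlt : ∀ z, Metric.infDist z W < ρ → z ∈ S := fun z hz => by
    obtain ⟨w, hw, hzw⟩ := (Metric.infDist_lt_iff hWne).1 hz
    exact hWS w hw z (by rw [← dist_eq_norm]; exact hzw.le)
  obtain ⟨y, hy⟩ := (Set.ne_univ_iff_exists_notMem S).1 hS
  obtain ⟨w, hw⟩ := hWne
  obtain ⟨y', hy'⟩ : ρ / 2 ∈ Set.range fun z => Metric.infDist z W :=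
    mem_range_of_exists_le_of_exists_ge (Metric.continuous_infDist_pt W)
      ⟨w, by rw [Metric.infDist_zero_of_mem hw]; positivity⟩
      ⟨y, by have : ρ ≤ Metric.infDist y W := by
               by_contra! hcon
               exact hy (hlt y hcon)
             linarith⟩
  simp only at hy'
  have hball : Metric.ball y' (ρ / 2) ⊆ S \ W := by
    intro z hz
    rw [Metric.mem_ball] at hz
    refine ⟨hlt z ?_, fun hzW => ?_⟩
    · have := Metric.infDist_le_infDist_add_dist (s := W) (x := z) (y := y')
      linarith
    · have := Metric.infDist_le_dist_of_mem (x := y') hzW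
      rw [dist_comm] at this
      linarith
  have h1 : volume (Metric.ball (0 : Euc n) (ρ / 2)) ≤ volume ((S \ W) ∩ unitCell n) := by
    rw [← Measure.addHaar_ball_center volume y']
    refine volume_le_of_disjoint_translates measurableSet_ball (fun k x hx hx' => ?_) ?_ hball
    · refine intVec_eq_zero_of_norm_lt_one ?_
      rw [Metric.mem_ball] at hx hx'
      have h2 := dist_triangle_right (x + intVec k) x y'
      rw [dist_eq_norm, add_sub_cancel_left] at h2
      linarith
    · intro x k
      exact propext (and_congr (iff_of_eq (hSp x k)) (not_congr (iff_of_eq (hWp x k))))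
  refine (add_le_add_right h1 _).trans ?_
  rw [← measure_union (Disjoint.mono Set.inter_subset_left Set.inter_subset_left
    Set.disjoint_sdiff_right) ((hSm.diff hWm).inter measurableSet_unitCell)]
  refine measure_mono (Set.union_subset ?_ ?_)
  · exact Set.inter_subset_inter_left _ fun w hw => hWS w hw w (by simpa using hρ.le)
  · exact Set.inter_subset_inter_left _ Set.sdiff_subset

end Volume

/-! ### The Jacobian of a near-identity map -/

section Determinant
variable {n : ℕ}

/-- Near the identity, the determinant of a trace-free perturbation is `1` up to first order. -/
lemma exists_one_sub_le_det {θ : ℝ} (hθ : 0 < θ) :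
    ∃ ε : ℝ, 0 < ε ∧ ∀ A : Euc n →L[ℝ] Euc n, ‖A‖ ≤ ε →
      ∑ i, (A (EuclideanSpace.single i 1)) i = 0 →
      1 - θ * ‖A‖ ≤ (ContinuousLinearMap.id ℝ (Euc n) + A).det := by
  set e := (EuclideanSpace.basisFun (Fin n) ℝ).toBasis with he
  set mat : (Euc n →L[ℝ] Euc n) → Matrix (Fin n) (Fin n) ℝ := fun A =>
    LinearMap.toMatrix e e A.toLinearMap with hmat
  have hentry : ∀ A i j, mat A i j = (A (EuclideanSpace.single j 1)) i := fun A i j => by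
    simp [hmat, he, LinearMap.toMatrix_apply]
  set f : (Euc n →L[ℝ] Euc n) → ℝ := fun A => (1 + mat A).det with hf
  have hdet : ∀ A, (ContinuousLinearMap.id ℝ (Euc n) + A).det = f A := fun A => by
    rw [ContinuousLinearMap.det, ← LinearMap.det_toMatrix e]
    simp [hf, hmat]
  have hfd : Differentiable ℝ f := by
    have : f = fun A => ∑ σ : Equiv.Perm (Fin n), (Equiv.Perm.sign σ : ℤ) •
        ∏ i, ((1 : Matrix (Fin n) (Fin n) ℝ) (σ i) i + (A (EuclideanSpace.single i 1)) (σ i)) := by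
      ext A
      rw [hf]
      simp only [Matrix.det_apply, Matrix.add_apply, hentry]
      rfl
    rw [this]
    fun_prop
  have hmatlin : ∀ (t : ℝ) A, mat (t • A) = t • mat A := fun t A => by
    ext i j; simp [hentry]
  have hf0 : f 0 = 1 := by
    have : mat 0 = 0 := by ext i j; simp [hentry]
    simp [hf, this]
  have hder : ∀ A, fderiv ℝ f 0 A = (mat A).trace := by
    intro A
    have h1 : HasDerivAt (fun t : ℝ => f (t • A)) (fderiv ℝ f 0 A) 0 := by
      have h2 : HasDerivAt (fun t : ℝ => t • A) A 0 := by
        simpa using (hasDerivAt_id (0 : ℝ)).smul_const A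
      have h3 : HasFDerivAt f (fderiv ℝ f 0) ((0 : ℝ) • A) := by
        have h4 : (0 : ℝ) • A = 0 := zero_smul ℝ A
        rw [h4]
        exact (hfd 0).hasFDerivAt
      exact h3.comp_hasDerivAt 0 h2
    have h2 : HasDerivAt (fun t : ℝ => f (t • A)) (mat A).trace 0 := by
      set p := (Matrix.det (1 + (Polynomial.X : Polynomial ℝ) •
        (mat A).map Polynomial.C)).divX.divX
      have h4 : (fun t : ℝ => f (t • A)) =
          fun t => 1 + (mat A).trace * t + p.eval t * t ^ 2 := by
        ext t
        rw [hf]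
        simp only [hmatlin]
        rw [Matrix.det_one_add_smul]
      rw [h4]
      have h3 := (((hasDerivAt_id (0 : ℝ)).const_mul (mat A).trace).const_add 1).add
        ((p.hasDerivAt 0).mul ((hasDerivAt_id (0 : ℝ)).pow 2))
      refine h3.congr_deriv ?_
      simp
    exact h1.unique h2
  have hlo := (hfd 0).hasFDerivAt.isLittleO.def hθ
  obtain ⟨ε, hε, hball⟩ := Metric.eventually_nhds_iff_ball.1 hlo
  refine ⟨ε / 2, by positivity, fun A hA htr => ?_⟩
  have h := hball A (by simpa using hA.trans_lt (by linarith))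
  have htr' : (mat A).trace = 0 := by
    rw [Matrix.trace, ← htr]
    exact Finset.sum_congr rfl fun i _ => hentry A i i
  rw [hf0, sub_zero, hder, htr', sub_zero, Real.norm_eq_abs] at h
  rw [hdet]
  linarith [(abs_le.1 h).1]

end Determinant

/-! ### The oscillation bound for incompressible drifts -/

section Controllability
variable {n : ℕ}

/-- A `C¹` periodic vector field has bounded derivative and is Lipschitz. -/
lemma TorusPeriodic.exists_lipschitz {b : Euc n → Euc n} (hb : ContDiff ℝ 1 b)
    (hbp : TorusPeriodic b) :
    ∃ L : ℝ, 0 ≤ L ∧ (∀ x, ‖fderiv ℝ b x‖ ≤ L) ∧ ∀ x y, ‖b x - b y‖ ≤ L * ‖x - y‖ := by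
  have hper : TorusPeriodic (fderiv ℝ b) := fun x k => by
    have h1 : (fun z => b (z + WithLp.toLp 2 (fun i => (k i : ℝ)))) = b := funext fun z => hbp z k
    rw [← fderiv_comp_add_right, h1]
  obtain ⟨L, hL, hbd⟩ := hper.exists_bound (hb.continuous_fderiv (by norm_num))
  refine ⟨L, hL, hbd, fun x y => ?_⟩
  exact Convex.norm_image_sub_le_of_norm_fderiv_le (𝕜 := ℝ)
    (fun z _ => hb.differentiable (by norm_num) z) (fun z _ => hbd z) convex_univ
    (Set.mem_univ y) (Set.mem_univ x)

/-- Bounds of a subsolution propagate along the Euler polygons of `b`: after the `k` steps making up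
the time `T`, a bound near `x` has become a bound on a ball of radius `T / 2`, regardless of how
small the step and the initial neighbourhood are. -/
lemma IsSubsol.le_on_euler_ball {b : Euc n → Euc n} {u : Euc n → ℝ} {K B L M : ℝ}
    (hu : Continuous u) (huB : ∀ x, |u x| ≤ B)
    (hsub : IsSubsol (fun _ P x => ‖P‖ + ⟪b x, P⟫ - K) u) (hK : 0 ≤ K) (hL : 0 ≤ L)
    (hbL : ∀ x y, ‖b x - b y‖ ≤ L * ‖x - y‖) (hbM : ∀ x, ‖b x‖ ≤ M) {T : ℝ} (hT : 0 < T)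
    (hTL : L * (T * M + T + T / 2) ≤ 1 / 2) {k : ℕ} {h : ℝ} (hh : 0 < h)
    (hkh : k * h = T) {x : Euc n} {η m : ℝ} (hη : 0 < η) (hηT : η ≤ T)
    (hm : ∀ z, ‖z - x‖ ≤ η → u z ≤ m) :
    ∀ j : ℕ, j ≤ k → ∀ z, ‖z - (fun z => z + h • b z)^[j] x‖ ≤ η * (k - j) / k + j * h / 2 →
      u z ≤ m + K * h * j := by
  intro j
  have hM : 0 ≤ M := (norm_nonneg _).trans (hbM x)
  induction j with
  | zero =>
    intro _ z hz
    have hk : (k : ℝ) ≠ 0 := by rintro h0; rw [h0] at hkh; linarith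
    simp only [Nat.cast_zero, sub_zero, zero_mul, zero_div, add_zero, mul_zero] at hz ⊢
    rw [mul_div_cancel_right₀ _ hk] at hz
    exact hm z hz
  | succ j ih =>
    intro hj z hz
    have hk : (0 : ℝ) < k := by exact_mod_cast (Nat.succ_pos j).trans_le hj
    have hjk : ((j : ℝ) + 1) ≤ k := by exact_mod_cast hj
    set y := (fun z => z + h • b z)^[j] x with hy
    set r : ℝ := η * (k - (j + 1)) / k + j * h / 2 with hr
    have hr0 : 0 ≤ r := by
      have : (0 : ℝ) ≤ k - (j + 1) := by linarith
      positivity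
    have hrη : r + η / k = η * (k - j) / k + j * h / 2 := by simp only [hr]; field_simp; ring
    have key := hsub.le_on_moving_ball hu huB hK (x := y) (b₀ := b y) (r := r) (η := η / k)
      (h := h) (m := m + K * h * j) hr0 (by positivity) hh.le (fun z hz => ?_)
      (fun z hz => ih (by omega) z (by rwa [hrη] at hz)) z (by
        rw [Function.iterate_succ_apply'] at hz
        refine hz.trans (le_of_eq ?_)
        push_cast
        simp only [hr]; ring)
    · refine key.trans (le_of_eq ?_)
      push_cast; ring
    · refine (hbL z y).trans (le_trans ?_ hTL)
      gcongr
      have h1 : h * ‖b y‖ ≤ T * M := by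
        have : h ≤ T := by rw [← hkh]; nlinarith
        gcongr
        exact hbM y
      have h2 : η * (k - j) / k ≤ η := by
        rw [div_le_iff₀ hk]
        have : (0 : ℝ) ≤ j := by positivity
        nlinarith
      have h3 : (j + 1) * h ≤ T := by rw [← hkh]; gcongr
      have h4 : h * ‖b y‖ + r + h / 2 + η / k = h * ‖b y‖ + (r + η / k) + h / 2 := by ring
      rw [h4, hrη] at hz
      linarith

/-- For a divergence-free field `b`, periodic subsolutions of `‖Du‖ + b · Du ≤ K` have oscillation
bounded in terms of `b` and `K` only. The sublevel sets of `u` grow: transporting them by the almost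
volume preserving Euler scheme and enlarging them by a fixed radius gains a fixed amount of volume,
so that after a bounded number of steps they fill the torus. -/
theorem exists_oscillation_bound {b : Euc n → Euc n} (hb : ContDiff ℝ 1 b) (hbp : TorusPeriodic b)
    (hdiv : ∀ x, ∑ i, (fderiv ℝ b x (EuclideanSpace.single i 1)) i = 0) :
    ∃ C : ℝ, 0 ≤ C ∧ ∀ (u : Euc n → ℝ) (K : ℝ), Continuous u → TorusPeriodic u → 0 ≤ K →
      IsSubsol (fun _ P x => ‖P‖ + ⟪b x, P⟫ - K) u → ∀ x y, u x - u y ≤ C * (K + 1) := by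
  obtain ⟨L, hL, hbL', hbL⟩ := hbp.exists_lipschitz hb
  obtain ⟨M, hM, hbM⟩ := hbp.exists_bound hb.continuous
  -- the time span `T` of one round
  obtain ⟨T, hT, hT1, hTL⟩ : ∃ T : ℝ, 0 < T ∧ T ≤ 1 ∧ L * (T * M + T + T / 2) ≤ 1 / 2 := by
    refine ⟨1 / ((2 * L + 1) * (M + 2)), by positivity, ?_, ?_⟩
    · rw [div_le_one (by positivity)]; nlinarith [mul_nonneg hL hM]
    · have : L * (1 / ((2 * L + 1) * (M + 2)) * M + 1 / ((2 * L + 1) * (M + 2)) +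
          1 / ((2 * L + 1) * (M + 2)) / 2) = L * (M + 3 / 2) / ((2 * L + 1) * (M + 2)) := by
        field_simp; ring
      rw [this, div_le_iff₀ (by positivity)]
      nlinarith [mul_nonneg hL hM]
  set ball : Set (Euc n) := Metric.ball 0 (T / 2 / 2) with hball
  set v : ℝ := (volume ball).toReal with hv
  have hballtop : volume ball ≠ ⊤ := measure_ball_lt_top.ne
  have hv0 : 0 < v := ENNReal.toReal_pos
    (Metric.measure_ball_pos volume 0 (by positivity)).ne' hballtop
  set vol : Set (Euc n) → ℝ := fun S => (volume (S ∩ unitCell n)).toReal with hvol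
  have hfin : ∀ S : Set (Euc n), volume (S ∩ unitCell n) ≠ ⊤ := fun S =>
    measure_ne_top_of_subset Set.inter_subset_right volume_unitCell_ne_top
  set V : ℝ := (volume (unitCell n)).toReal with hV
  have hV0 : 0 ≤ V := ENNReal.toReal_nonneg
  have hvolV : ∀ S, vol S ≤ V := fun S =>
    ENNReal.toReal_mono volume_unitCell_ne_top (measure_mono Set.inter_subset_right)
  have hvolnn : ∀ S, 0 ≤ vol S := fun S => ENNReal.toReal_nonneg
  -- the relative volume `θ T` lost by the Euler scheme is negligible compared to the gain `v`
  set θ : ℝ := v / (2 * T * (V + 1)) with hθ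
  have hθ0 : 0 < θ := by positivity
  have hθV : θ * T * V ≤ v / 2 := by
    have : θ * T * (V + 1) = v / 2 := by simp only [hθ]; field_simp
    nlinarith [mul_pos hθ0 hT]
  obtain ⟨ε, hε, hdet⟩ := exists_one_sub_le_det (n := n) (θ := θ / (L + 1)) (by positivity)
  obtain ⟨k, h, hh, hkh, hhε, hhL, hhθ⟩ : ∃ (k : ℕ) (h : ℝ), 0 < h ∧ k * h = T ∧
      h * L ≤ ε ∧ h * L < 1 ∧ θ * h ≤ 1 := by
    set h₀ : ℝ := min (ε / (L + 1)) (min (1 / (L + 1)) (1 / θ)) with hh₀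
    have hh₀0 : 0 < h₀ := by positivity
    obtain ⟨k, hk⟩ := exists_nat_gt (T / h₀)
    have hk0 : (0 : ℝ) < k := lt_trans (by positivity) hk
    have hle : T / k ≤ h₀ := by
      rw [div_lt_iff₀ hh₀0] at hk
      rw [div_le_iff₀ hk0]; linarith
    have h1 : T / k * (L + 1) ≤ ε := by
      rw [← le_div_iff₀ (by positivity)]; exact hle.trans (min_le_left _ _)
    have h2 : T / k * (L + 1) ≤ 1 := by
      rw [← le_div_iff₀ (by positivity)]
      exact hle.trans ((min_le_right _ _).trans (min_le_left _ _))
    have h3 : T / k * θ ≤ 1 := by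
      rw [← le_div_iff₀ (by positivity)]
      exact hle.trans ((min_le_right _ _).trans (min_le_right _ _))
    have h4 : 0 < T / k := by positivity
    exact ⟨k, T / k, h4, by field_simp, by linarith, by linarith, by linarith⟩
  set Ψ : Euc n → Euc n := fun z => z + h • b z with hΨ
  have hΨd : ∀ x, HasFDerivAt Ψ (ContinuousLinearMap.id ℝ (Euc n) + h • fderiv ℝ b x) x := fun x =>
    (hasFDerivAt_id x).add ((hb.differentiable (by norm_num) x).hasFDerivAt.const_smul h)
  have hΨinj : Function.Injective Ψ := by
    intro x y hxy
    have h1 : x - y = h • (b y - b x) := by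
      have h2 : x + h • b x = y + h • b y := hxy
      rw [smul_sub, sub_eq_sub_iff_add_eq_add, h2, add_comm]
    have h2 : ‖x - y‖ ≤ h * L * ‖x - y‖ := by
      calc ‖x - y‖ = h * ‖b y - b x‖ := by rw [h1, norm_smul, Real.norm_of_nonneg hh.le]
        _ ≤ h * (L * ‖y - x‖) := by gcongr; exact hbL y x
        _ = h * L * ‖x - y‖ := by rw [norm_sub_rev y x]; ring
    have h3 : ‖x - y‖ = 0 := by
      by_contra hne
      have : 0 < ‖x - y‖ := lt_of_le_of_ne (norm_nonneg _) (Ne.symm hne)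
      nlinarith
    exact sub_eq_zero.1 (norm_eq_zero.1 h3)
  have hΨper : ∀ x (k : Fin n → ℤ), Ψ (x + intVec k) = Ψ x + intVec k := fun x k => by
    simp only [hΨ, hbp.add_intVec]; abel
  have hΨdet : ∀ x, 1 - θ * h ≤ |(ContinuousLinearMap.id ℝ (Euc n) + h • fderiv ℝ b x).det| := by
    intro x
    have hn : ‖h • fderiv ℝ b x‖ ≤ h * L := by
      rw [norm_smul, Real.norm_of_nonneg hh.le]; gcongr; exact hbL' x
    have h1 := hdet (h • fderiv ℝ b x) (hn.trans hhε) (by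
      simp only [smul_apply, PiLp.smul_apply, smul_eq_mul,
        ← Finset.mul_sum, hdiv x, mul_zero])
    refine le_trans ?_ (h1.trans (le_abs_self _))
    have h2 : θ / (L + 1) * ‖h • fderiv ℝ b x‖ ≤ θ / (L + 1) * (h * L) := by gcongr
    have h3 : θ / (L + 1) * (h * L) ≤ θ * h := by
      rw [div_mul_eq_mul_div, div_le_iff₀ (by positivity)]
      nlinarith [mul_pos hθ0 hh]
    linarith
  obtain ⟨N, hN⟩ := exists_nat_gt (V / (v / 2))
  rw [div_lt_iff₀ (by positivity)] at hN
  refine ⟨(N + 2) * T, by positivity, fun u K huc hup hK hsub x y => ?_⟩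
  obtain ⟨B, -, huB⟩ := hup.exists_bound huc
  set Δ : ℝ := (K + 1) * T with hΔ
  have hΔ0 : 0 < Δ := by positivity
  set S : ℝ → Set (Euc n) := fun t => {z | u z < t} with hS
  have hSo : ∀ t, IsOpen (S t) := fun t => isOpen_lt huc continuous_const
  have hSp : ∀ t, TorusPeriodic (fun x => x ∈ S t) := fun t z k => by
    change (u (z + intVec k) < t) = (u z < t)
    rw [hup.add_intVec]
  have step : ∀ t, (S t).Nonempty → S (t + Δ) ≠ Set.univ → vol (S t) + v / 2 ≤ vol (S (t + Δ)) := by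
    intro t hne huniv
    obtain ⟨hWm, hWp, hWv⟩ := volume_iterate_image_ge hΨd hΨinj hΨper hhθ hΨdet
      (hSo t).measurableSet (hSp t) k
    have hsubset : ∀ w ∈ Ψ^[k] '' S t, ∀ z, ‖z - w‖ ≤ T / 2 → z ∈ S (t + Δ) := by
      rintro _ ⟨y, hy, rfl⟩ z hz
      obtain ⟨η, hη, hηS⟩ := Metric.isOpen_iff.1 (hSo t) y hy
      have hη' : 0 < min (η / 2) T := by positivity
      have hk0 : (k : ℝ) ≠ 0 := by rintro h0; rw [h0] at hkh; linarith
      have := hsub.le_on_euler_ball huc (fun x => huB x) hK hL hbL hbM hT hTL hh hkh hη'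
        (min_le_right _ _) (x := y) (m := t) (fun z hz => by
          have h1 : z ∈ S t := hηS (by
            rw [Metric.mem_ball, dist_eq_norm]
            exact (hz.trans (min_le_left _ _)).trans_lt (by linarith))
          exact le_of_lt h1) k le_rfl z (by
          rw [sub_self, mul_zero, zero_div, zero_add, hkh]; exact hz)
      have h2 : K * h * k = K * T := by rw [← hkh]; ring
      change u z < t + Δ
      rw [h2] at this
      simp only [hΔ]; linarith
    have h1 := volume_enlarge_ge (by positivity) (by linarith) hWm (hne.image _) hWp
      (hSo _).measurableSet (hSp _) hsubset huniv
    have h2 : (1 - θ * T) * vol (S t) ≤ vol (Ψ^[k] '' S t) := by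
      have h3 := ENNReal.toReal_mono (hfin _) hWv
      rw [ENNReal.toReal_mul, ENNReal.toReal_ofReal (pow_nonneg (by linarith) _)] at h3
      refine le_trans ?_ h3
      gcongr
      have := one_add_mul_le_pow (a := -(θ * h)) (by linarith) k
      rw [← sub_eq_add_neg] at this
      refine le_trans (le_of_eq ?_) this
      rw [← hkh]; ring
    have h3 := ENNReal.toReal_mono (hfin _) h1
    rw [ENNReal.toReal_add (hfin _) hballtop] at h3
    have h4 : θ * T * vol (S t) ≤ θ * T * V := by gcongr; exact hvolV _
    simp only [hvol] at *
    linarith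
  have hgrow : ∀ j : ℕ, S (u y + Δ + j * Δ) = Set.univ ∨
      j * (v / 2) ≤ vol (S (u y + Δ + j * Δ)) := by
    intro j
    induction j with
    | zero => right; simpa using hvolnn _
    | succ j ih =>
      have hcast : u y + Δ + ((j + 1 : ℕ) : ℝ) * Δ = (u y + Δ + j * Δ) + Δ := by push_cast; ring
      rw [hcast]
      have hmem : y ∈ S (u y + Δ + j * Δ) := by
        have : 0 ≤ (j : ℝ) * Δ := by positivity
        change u y < _
        linarith
      rcases ih with ih | ih
      · left
        refine Set.eq_univ_of_forall fun z => ?_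
        have h1 : u z < u y + Δ + j * Δ :=
          (ih ▸ Set.mem_univ z : z ∈ S (u y + Δ + j * Δ))
        change u z < _
        linarith
      · by_cases hu : S (u y + Δ + j * Δ + Δ) = Set.univ
        · exact Or.inl hu
        · right
          have := step _ ⟨y, hmem⟩ hu
          push_cast; linarith
  have huniv : S (u y + Δ + N * Δ) = Set.univ := (hgrow N).resolve_right fun hcon => by
    have := hvolV (S (u y + Δ + N * Δ))
    linarith
  have hx : u x < u y + Δ + N * Δ := (huniv ▸ Set.mem_univ x : x ∈ S (u y + Δ + N * Δ))
  have h1 : ((N : ℝ) + 2) * T * (K + 1) = Δ + N * Δ + Δ := by simp only [hΔ]; ring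
  linarith

end Controllability

/-! ### Cell problems: uniqueness of the level and existence of correctors -/

section Effective
variable {n : ℕ}

/-- The standing assumptions on a Hamiltonian `H(P, x)`: continuity, periodicity in `x`, and the
modulus of continuity in `x` which makes doubling of variables work. -/
structure IsAdmissibleHamiltonian (H : Euc n → Euc n → ℝ) : Prop where
  continuous : Continuous fun q : Euc n × Euc n => H q.1 q.2
  periodic : ∀ P, TorusPeriodic (H P)
  modulus : ∃ C : ℝ, 0 ≤ C ∧ ∀ P x y, |H P x - H P y| ≤ C * (1 + ‖P‖) * ‖x - y‖

lemma IsAdmissibleHamiltonian.shift {H : Euc n → Euc n → ℝ} (hH : IsAdmissibleHamiltonian H)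
    (p : Euc n) : IsAdmissibleHamiltonian fun P x => H (p + P) x := by
  obtain ⟨hc, hp, C, hC, hm⟩ := hH
  refine ⟨hc.comp (by fun_prop : Continuous fun q : Euc n × Euc n => (p + q.1, q.2)),
    fun P => hp _, C * (1 + ‖p‖), by positivity, fun P x y => (hm _ _ _).trans ?_⟩
  rw [mul_assoc C (1 + ‖p‖)]
  gcongr
  nlinarith [norm_add_le p P, norm_nonneg p, norm_nonneg P, mul_nonneg (norm_nonneg p)
    (norm_nonneg P)]

lemma IsAdmissibleHamiltonian.exists_bound_zero {H : Euc n → Euc n → ℝ}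
    (hH : IsAdmissibleHamiltonian H) : ∃ K : ℝ, 0 ≤ K ∧ ∀ x, |H 0 x| ≤ K := by
  have hc : Continuous (H 0) := hH.continuous.comp
    (by fun_prop : Continuous fun x : Euc n => ((0 : Euc n), x))
  exact (hH.periodic 0).exists_bound hc

/-- A periodic subsolution at level `c₁` and a periodic supersolution at level `c₂` of the same cell
problem force `c₂ ≤ c₁`. -/
theorem level_le_of_sub_of_super {H : Euc n → Euc n → ℝ} (hH : IsAdmissibleHamiltonian H)
    {p : Euc n} {c₁ c₂ : ℝ} {u w : Euc n → ℝ} (hup : TorusPeriodic u) (hwp : TorusPeriodic w)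
    (hu : IsViscositySubsolution (fun P x => H (p + P) x - c₁) u)
    (hw : IsViscositySupersolution (fun P x => H (p + P) x - c₂) w) : c₂ ≤ c₁ := by
  obtain ⟨huc, hu⟩ := isViscositySubsolution_iff.1 hu
  obtain ⟨hwc, hw⟩ := isViscositySupersolution_iff.1 hw
  obtain ⟨B₁, -, hB₁⟩ := hup.exists_bound huc
  obtain ⟨B₂, -, hB₂⟩ := hwp.exists_bound hwc
  obtain ⟨C, hC, hm⟩ := (hH.shift p).modulus
  refine le_of_forall_pos_le_add fun ε hε => ?_
  obtain ⟨x, y, P, hxy, hPxy, -, h1, h2⟩ := exists_doubling hup hwp huc.upperSemicontinuous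
    hwc.lowerSemicontinuous (fun x => (hB₁ x).trans (le_max_left B₁ B₂))
    (fun x => (hB₂ x).trans (le_max_right B₁ B₂)) hu hw
    (ε := ε / (2 * C + 1)) (by positivity)
  have h3 := (abs_le.1 (hm P x y)).1
  have h4 : C * (1 + ‖P‖) * ‖x - y‖ ≤ ε := by
    have h5 : (1 + ‖P‖) * ‖x - y‖ ≤ 2 * (ε / (2 * C + 1)) := by linarith
    have h6 : ε / (2 * C + 1) * (2 * C + 1) = ε := by field_simp
    have h7 : 0 < ε / (2 * C + 1) := by positivity
    nlinarith
  linarith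

lemma AdmitsPeriodicSolution.admitsApprox {H : Euc n → Euc n → ℝ} {p : Euc n} {c : ℝ}
    (h : AdmitsPeriodicSolution H p c) : AdmitsApproxPeriodicSolutions H p c := by
  intro ε hε
  obtain ⟨u, hup, hu, hu'⟩ := h
  rw [isViscositySubsolution_iff] at hu
  rw [isViscositySupersolution_iff] at hu'
  refine ⟨u, hup, isViscositySubsolution_iff.2 ⟨hu.1, hu.2.mono fun P x => by linarith⟩,
    isViscositySupersolution_iff.2 ⟨hu'.1, hu'.2.mono fun P x => by linarith⟩⟩

lemma le_of_admitsApprox_of_super {H : Euc n → Euc n → ℝ} (hH : IsAdmissibleHamiltonian H)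
    {p : Euc n} {c c' : ℝ} (h : AdmitsApproxPeriodicSolutions H p c) {w : Euc n → ℝ}
    (hwp : TorusPeriodic w)
    (hw : IsViscositySupersolution (fun P x => H (p + P) x - c') w) : c' ≤ c := by
  refine le_of_forall_pos_le_add fun ε hε => ?_
  obtain ⟨u, hup, hu, -⟩ := h ε hε
  exact level_le_of_sub_of_super hH hup hwp hu hw

lemma le_of_admitsApprox_of_sub {H : Euc n → Euc n → ℝ} (hH : IsAdmissibleHamiltonian H)
    {p : Euc n} {c c' : ℝ} (h : AdmitsApproxPeriodicSolutions H p c) {u : Euc n → ℝ}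
    (hup : TorusPeriodic u)
    (hu : IsViscositySubsolution (fun P x => H (p + P) x - c') u) : c ≤ c' := by
  refine le_of_forall_pos_le_add fun ε hε => ?_
  obtain ⟨w, hwp, -, hw⟩ := h ε hε
  linarith [level_le_of_sub_of_super hH hup hwp hu hw]

lemma AdmitsApproxPeriodicSolutions.unique {H : Euc n → Euc n → ℝ}
    (hH : IsAdmissibleHamiltonian H) {p : Euc n} {c c' : ℝ}
    (h : AdmitsApproxPeriodicSolutions H p c) (h' : AdmitsApproxPeriodicSolutions H p c') :
    c = c' := by
  have key : ∀ {c c' : ℝ}, AdmitsApproxPeriodicSolutions H p c →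
      AdmitsApproxPeriodicSolutions H p c' → c ≤ c' := fun {c c'} h h' => by
    refine le_of_forall_pos_le_add fun ε hε => ?_
    obtain ⟨u, hup, hu, -⟩ := h' ε hε
    exact le_of_admitsApprox_of_sub hH h hup hu
  exact le_antisymm (key h h') (key h' h)

lemma theUniqueNumber_spec {P : ℝ → Prop} (h : ∃! c, P c) : P (theUniqueNumber P) := by
  rw [theUniqueNumber, dif_pos h]
  exact h.choose_spec.1

/-- The small discount limit: if all periodic subsolutions at a certain level `K` have bounded
oscillation, the cell problem has approximate solutions, obtained from the discounted problems. They
can be chosen to be subsolutions at level `K`. -/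
theorem exists_approx_correctors {H : Euc n → Euc n → ℝ} (hH : IsAdmissibleHamiltonian H)
    {K : ℝ} (hK : ∀ x, |H 0 x| ≤ K) {D : ℝ}
    (hosc : ∀ u : Euc n → ℝ, Continuous u → TorusPeriodic u →
      IsSubsol (fun _ P x => H P x - K) u → ∀ x y, u x - u y ≤ D) :
    ∃ c : ℝ, ∀ ε : ℝ, 0 < ε → ∃ u : Euc n → ℝ, Continuous u ∧ TorusPeriodic u ∧ u 0 = 0 ∧
      IsSubsol (fun _ P x => H P x - K) u ∧ IsSubsol (fun _ P x => H P x - (c + ε)) u ∧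
      IsSupersol (fun _ P x => H P x - (c - ε)) u := by
  obtain ⟨C, hC, hm⟩ := hH.modulus
  set l : ℕ → ℝ := fun k => 1 / ((k : ℝ) + 1) with hl
  have hl0 : ∀ k, 0 < l k := fun k => by simp only [hl]; positivity
  have hlim : Tendsto l atTop (𝓝 0) := tendsto_one_div_add_atTop_nhds_zero_nat
  choose w hwc hwp hwK hws hwS using fun k =>
    exists_discounted_solution hH.continuous hH.periodic hC hm hK (hl0 k)
  have hwKsub : ∀ k, IsSubsol (fun _ P x => H P x - K) (w k) := fun k =>
    (hws k).mono fun P x => by linarith [(abs_le.1 (hwK k x)).1]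
  obtain ⟨c, -, ι, hι, hc⟩ := (isCompact_Icc (a := -K) (b := K)).tendsto_subseq
    (x := fun k => -(l k * w k 0)) fun k => by
      have := abs_le.1 (hwK k 0)
      constructor <;> linarith
  refine ⟨c, fun ε hε => ?_⟩
  have h1 : ∀ᶠ k in atTop, |-(l (ι k) * w (ι k) 0) - c| < ε / 2 :=
    (Metric.tendsto_nhds.1 hc) (ε / 2) (by positivity)
  have h2 : ∀ᶠ k in atTop, l (ι k) * D < ε / 2 := by
    have : Tendsto (fun k => l (ι k) * D) atTop (𝓝 (0 * D)) :=
      (hlim.comp hι.tendsto_atTop).mul_const D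
    exact this.eventually_lt_const (by rw [zero_mul]; positivity)
  obtain ⟨k, hk1, hk2⟩ := (h1.and h2).exists
  have hk1 := abs_lt.1 hk1
  have hup : ∀ x, l (ι k) * w (ι k) x - l (ι k) * w (ι k) 0 ≤ l (ι k) * D := fun x => by
    rw [← mul_sub]
    exact mul_le_mul_of_nonneg_left (hosc _ (hwc _) (hwp _) (hwKsub _) x 0) (hl0 _).le
  have hdown : ∀ x, l (ι k) * w (ι k) 0 - l (ι k) * w (ι k) x ≤ l (ι k) * D := fun x => by
    rw [← mul_sub]
    exact mul_le_mul_of_nonneg_left (hosc _ (hwc _) (hwp _) (hwKsub _) 0 x) (hl0 _).le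
  refine ⟨fun x => w (ι k) x - w (ι k) 0, (hwc _).sub continuous_const, fun x m => ?_, sub_self _,
    (hwKsub _).sub_const _, ?_, ?_⟩
  · simp only [hwp (ι k) x m]
  · refine IsSubsol.sub_const (F := fun _ P x => H P x - (c + ε)) ?_ _
    refine (hws (ι k)).mono fun P x => ?_
    linarith [hup x, hdown x]
  · refine IsSupersol.sub_const (F := fun _ P x => H P x - (c - ε)) ?_ _
    refine (hwS (ι k)).mono fun P x => ?_
    linarith [hup x, hdown x]

/-- A subsolution of `‖Du‖ ≤ R` is Lipschitz. -/
lemma IsSubsol.lipschitz {u : Euc n → ℝ} {R B : ℝ} (hu : Continuous u) (huB : ∀ x, |u x| ≤ B)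
    (hR : 0 ≤ R) (hsub : IsSubsol (fun _ P _ => ‖P‖ - R) u) (x y : Euc n) :
    |u x - u y| ≤ 2 * R * ‖x - y‖ := by
  have key : ∀ x y, u x - u y ≤ 2 * R * ‖x - y‖ := by
    intro x y
    refine le_of_forall_pos_le_add fun ε hε => ?_
    obtain ⟨η, hη, hball⟩ := Metric.continuous_iff.1 hu y ε hε
    have := IsSubsol.le_on_moving_ball (b := fun _ => 0) hu huB
      (hsub.mono fun P x => by simp) hR (x := y) (b₀ := 0) (r := 0) (η := η / 2)
      (h := 2 * ‖x - y‖) (m := u y + ε) le_rfl (by positivity) (by positivity)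
      (fun z _ => by simp) (fun z hz => by
        have h1 := hball z (by rw [dist_eq_norm]; linarith)
        rw [Real.dist_eq] at h1
        linarith [(abs_lt.1 h1).2]) x (by simp)
    linarith
  rw [abs_le]
  constructor
  · have := key y x
    rw [norm_sub_rev] at this
    linarith
  · exact key x y

/-- Approximate periodic solutions which are uniformly Lipschitz yield, by compactness, an exact
solution. -/
theorem exists_corrector_of_lipschitz {H : Euc n → Euc n → ℝ}
    (hH : Continuous fun q : Euc n × Euc n => H q.1 q.2) {c Λ : ℝ} (hΛ : 0 ≤ Λ)
    (happ : ∀ ε : ℝ, 0 < ε → ∃ u : Euc n → ℝ, TorusPeriodic u ∧ u 0 = 0 ∧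
      (∀ x y, |u x - u y| ≤ Λ * ‖x - y‖) ∧ IsSubsol (fun _ P x => H P x - (c + ε)) u ∧
      IsSupersol (fun _ P x => H P x - (c - ε)) u) :
    ∃ u : Euc n → ℝ, Continuous u ∧ TorusPeriodic u ∧ IsSubsol (fun _ P x => H P x - c) u ∧
      IsSupersol (fun _ P x => H P x - c) u := by
  have hcont : ∀ u : Euc n → ℝ, (∀ x y, |u x - u y| ≤ Λ * ‖x - y‖) → Continuous u := fun u hu =>
    (LipschitzWith.of_dist_le_mul (K := ⟨Λ, hΛ⟩) fun x y => by
      rw [Real.dist_eq, dist_eq_norm]; exact hu x y).continuous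
  set e : ℕ → ℝ := fun k => 1 / ((k : ℝ) + 1) with he
  have he0 : ∀ k, 0 < e k := fun k => by simp only [he]; positivity
  have hlim : Tendsto e atTop (𝓝 0) := tendsto_one_div_add_atTop_nhds_zero_nat
  choose w hwp hw0 hwL hws hwS using fun k => happ (e k) (he0 k)
  -- pointwise limits along a free ultrafilter
  have hex : ∀ x, ∃ a, Tendsto (fun k => w k x) (hyperfilter ℕ : Filter ℕ) (𝓝 a) := by
    intro x
    obtain ⟨a, -, ha⟩ := (isCompact_Icc (a := -(Λ * ‖x‖)) (b := Λ * ‖x‖)).ultrafilter_le_nhds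
      ((hyperfilter ℕ).map fun k => w k x) (by
        rw [Ultrafilter.coe_map, le_principal_iff, mem_map]
        refine univ_mem' fun k => ?_
        have := hwL k x 0
        rw [hw0, sub_zero, sub_zero] at this
        exact abs_le.1 this)
    exact ⟨a, ha⟩
  choose u hu using hex
  have huL : ∀ x y, |u x - u y| ≤ Λ * ‖x - y‖ := fun x y =>
    le_of_tendsto ((hu x).sub (hu y)).abs (Eventually.of_forall fun k => hwL k x y)
  have hup : TorusPeriodic u := fun x m => by
    refine tendsto_nhds_unique (hu _) ((hu x).congr fun k => ?_)
    exact (hwp k x m).symm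
  have hunif : ∀ ε : ℝ, 0 < ε →
      ∀ᶠ k in (hyperfilter ℕ : Filter ℕ), ∀ x, |w k x - u x| ≤ ε := by
    intro ε hε
    set δ : ℝ := ε / (4 * (Λ + 1)) with hδ
    have hδ0 : 0 < δ := by positivity
    obtain ⟨t, -, htf, htc⟩ := (isCompact_closedBall (0 : Euc n) (√n)).finite_cover_balls hδ0
    have h1 : ∀ᶠ k in (hyperfilter ℕ : Filter ℕ), ∀ z ∈ t, |w k z - u z| < ε / 2 :=
      (eventually_all_finite htf).2 fun z _ => (Metric.tendsto_nhds.1 (hu z)) _ (by positivity)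
    filter_upwards [h1] with k hk x
    obtain ⟨m, hm⟩ := exists_norm_add_intVec_le x
    rw [← (hwp k).add_intVec x m, ← hup.add_intVec x m]
    set x' := x + intVec m
    obtain ⟨z, hz, hxz⟩ := Set.mem_iUnion₂.1 (htc (by simpa using hm : x' ∈ _))
    rw [Metric.mem_ball, dist_eq_norm] at hxz
    have h2 := abs_le.1 (hwL k x' z)
    have h3 := abs_le.1 (huL x' z)
    have h4 := abs_lt.1 (hk z hz)
    have h5 : Λ * ‖x' - z‖ ≤ ε / 4 := by
      have h6 : δ * (Λ + 1) = ε / 4 := by simp only [hδ]; field_simp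
      nlinarith [norm_nonneg (x' - z)]
    rw [abs_le]
    constructor <;> linarith
  have hFc : Continuous fun q : ℝ × Euc n × Euc n => H q.2.1 q.2.2 - c :=
    (hH.comp continuous_snd).sub continuous_const
  have hgood : ∀ ε : ℝ, 0 < ε → ∃ k, e k ≤ ε ∧ ∀ x, |w k x - u x| ≤ ε := fun ε hε =>
    (((hlim.eventually_le_const hε).filter_mono Nat.hyperfilter_le_atTop).and (hunif ε hε)).exists
  refine ⟨u, hcont u huL, hup, IsSubsol.of_uniform_limit hFc fun ε hε => ?_,
    IsSupersol.of_uniform_limit hFc fun ε hε => ?_⟩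
  · obtain ⟨k, hk, hku⟩ := hgood ε hε
    exact ⟨w k, hcont _ (hwL k), (hws k).mono fun P x => by linarith, hku⟩
  · obtain ⟨k, hk, hku⟩ := hgood ε hε
    exact ⟨w k, hcont _ (hwL k), (hwS k).mono fun P x => by linarith, hku⟩

end Effective

/-! ### The G-equation and the F-equation -/

section FlameSpeeds
variable {n : ℕ} {V : Euc n → Euc n}

lemma abs_inner_sub_le {L A : ℝ} (hL : ∀ x y, ‖V x - V y‖ ≤ L * ‖x - y‖) (P x y : Euc n) :
    |A * ⟪V x, P⟫ - A * ⟪V y, P⟫| ≤ |A| * L * (1 + ‖P‖) * ‖x - y‖ := by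
  rw [← mul_sub, abs_mul, ← inner_sub_left]
  have h1 := abs_real_inner_le_norm (V x - V y) P
  have h2 : ‖V x - V y‖ * ‖P‖ ≤ L * ‖x - y‖ * (1 + ‖P‖) := by
    have := (norm_nonneg _).trans (hL x y)
    gcongr
    · exact hL x y
    · linarith
  calc |A| * |⟪V x - V y, P⟫| ≤ |A| * (L * ‖x - y‖ * (1 + ‖P‖)) := by
        gcongr; exact h1.trans h2
    _ = _ := by ring

lemma isAdmissibleHamiltonian_G (hV : ContDiff ℝ 1 V) (hVp : TorusPeriodic V) (A : ℝ) :
    IsAdmissibleHamiltonian (hamiltonianG V A) := by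
  obtain ⟨L, hL, -, hLip⟩ := hVp.exists_lipschitz hV
  have hVc := hV.continuous
  refine ⟨by unfold hamiltonianG; fun_prop, fun P x k => ?_, |A| * L, by positivity,
    fun P x y => ?_⟩
  · simp only [hamiltonianG, hVp x k]
  · have := abs_inner_sub_le (A := A) hLip P x y
    simpa only [hamiltonianG, add_sub_add_left_eq_sub] using this

lemma isAdmissibleHamiltonian_F (hV : ContDiff ℝ 1 V) (hVp : TorusPeriodic V) (A : ℝ) :
    IsAdmissibleHamiltonian (hamiltonianF V A) := by
  obtain ⟨L, hL, -, hLip⟩ := hVp.exists_lipschitz hV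
  have hVc := hV.continuous
  refine ⟨by unfold hamiltonianF; fun_prop, fun P x k => ?_, |A| * L, by positivity,
    fun P x y => ?_⟩
  · simp only [hamiltonianF, hVp x k]
  · have := abs_inner_sub_le (A := A) hLip P x y
    simpa only [hamiltonianF, add_sub_add_left_eq_sub] using this

/-- The speed `α_A(p)` of the G-equation is well defined for divergence-free flows. -/
theorem speedG_spec (hV : ContDiff ℝ 1 V) (hVp : TorusPeriodic V)
    (hdiv : ∀ x, ∑ i, (fderiv ℝ V x (EuclideanSpace.single i 1)) i = 0) (A : ℝ) (p : Euc n) :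
    AdmitsApproxPeriodicSolutions (hamiltonianG V A) p (speedG V A p) := by
  have hH := isAdmissibleHamiltonian_G hV hVp A
  refine theUniqueNumber_spec (existsUnique_of_exists_of_unique ?_
    fun c c' h h' => h.unique hH h')
  have hH' := hH.shift p
  obtain ⟨K, hK0, hK⟩ := hH'.exists_bound_zero
  obtain ⟨M, hM, hVM⟩ := hVp.exists_bound hV.continuous
  obtain ⟨C, hC, hosc⟩ := exists_oscillation_bound (b := fun x => A • V x) (hV.const_smul A)
    (fun x k => by simp only [hVp x k]) (fun x => by
      have hd : fderiv ℝ (fun x => A • V x) x = A • fderiv ℝ V x :=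
        fderiv_fun_const_smul (hV.differentiable (by norm_num) x) A
      simp only [hd, smul_apply, PiLp.smul_apply, smul_eq_mul, ← Finset.mul_sum, hdiv x, mul_zero])
  set K' : ℝ := K + ‖p‖ + |A| * M * ‖p‖ with hK'
  obtain ⟨c, hc⟩ := exists_approx_correctors hH' hK (D := C * (K' + 1))
    fun u huc hup hu => by
      refine hosc u K' huc hup (by positivity) (hu.mono fun P x => ?_)
      have h1 : ‖P‖ ≤ ‖p + P‖ + ‖p‖ := by
        have := norm_sub_le (p + P) p
        rwa [add_sub_cancel_left] at this
      have h2 : -(|A| * M * ‖p‖) ≤ A * ⟪V x, p⟫ := by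
        have : |A * ⟪V x, p⟫| ≤ |A| * M * ‖p‖ := by
          rw [abs_mul, mul_assoc]
          gcongr
          exact (abs_real_inner_le_norm _ _).trans (by gcongr; exact hVM x)
        exact (abs_le.1 this).1
      simp only [hamiltonianG, inner_add_right, real_inner_smul_left]
      linarith
  refine ⟨c, fun ε hε => ?_⟩
  obtain ⟨u, huc, hup, -, -, hu, hu'⟩ := hc ε hε
  exact ⟨u, hup, isViscositySubsolution_iff.2 ⟨huc, hu⟩,
    isViscositySupersolution_iff.2 ⟨huc, hu'⟩⟩

/-- The effective Hamiltonian `β_A(p)` of the F-equation is well defined. -/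
theorem effectiveF_spec (hV : ContDiff ℝ 1 V) (hVp : TorusPeriodic V) (A : ℝ) (p : Euc n) :
    AdmitsPeriodicSolution (hamiltonianF V A) p (effectiveF V A p) := by
  have hH := isAdmissibleHamiltonian_F hV hVp A
  refine theUniqueNumber_spec (existsUnique_of_exists_of_unique ?_
    fun c c' h h' => h.admitsApprox.unique hH h'.admitsApprox)
  have hH' := hH.shift p
  obtain ⟨K, hK0, hK⟩ := hH'.exists_bound_zero
  obtain ⟨M, hM, hVM⟩ := hVp.exists_bound hV.continuous
  -- coercivity turns a level-`K` subsolution into a subsolution of `‖Du‖ ≤ R`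
  set R : ℝ := |A| * M + 1 + K + ‖p‖ with hR
  have hR0 : 0 ≤ R := by positivity
  have hcoer : ∀ u : Euc n → ℝ, IsSubsol (fun _ P x => hamiltonianF V A (p + P) x - K) u →
      IsSubsol (fun _ P _ => ‖P‖ - R) u := by
    intro u hu φ hφ x₀ hmax
    have h := hu φ hφ x₀ hmax
    simp only [hamiltonianF] at h
    set P := gradient φ x₀
    have h1 : ‖P‖ ≤ ‖p + P‖ + ‖p‖ := by
      have := norm_sub_le (p + P) p
      rwa [add_sub_cancel_left] at this
    have h2 : -(|A| * M * ‖p + P‖) ≤ A * ⟪V x₀, p + P⟫ := by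
      have : |A * ⟪V x₀, p + P⟫| ≤ |A| * M * ‖p + P‖ := by
        rw [abs_mul, mul_assoc]
        gcongr
        exact (abs_real_inner_le_norm _ _).trans (by gcongr; exact hVM x₀)
      exact (abs_le.1 this).1
    have h3 : ‖p + P‖ ≤ |A| * M + 1 + K := by
      by_contra! hcon
      have : 0 ≤ |A| * M := by positivity
      nlinarith
    simp only [hR]; linarith
  have hlip : ∀ u : Euc n → ℝ, Continuous u → TorusPeriodic u →
      IsSubsol (fun _ P x => hamiltonianF V A (p + P) x - K) u →
      ∀ x y, |u x - u y| ≤ 2 * R * ‖x - y‖ := by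
    intro u huc hup hu
    obtain ⟨B, -, hB⟩ := hup.exists_bound huc
    exact (hcoer u hu).lipschitz huc hB hR0
  obtain ⟨c, hc⟩ := exists_approx_correctors hH' hK (D := 2 * R * (2 * √n))
    fun u huc hup hu x y => by
      obtain ⟨k, hk⟩ := exists_norm_add_intVec_le x
      obtain ⟨m, hm⟩ := exists_norm_add_intVec_le y
      rw [← hup.add_intVec x k, ← hup.add_intVec y m]
      refine (le_abs_self _).trans ((hlip u huc hup hu _ _).trans ?_)
      gcongr
      exact (norm_sub_le _ _).trans (by linarith)
  obtain ⟨u, huc, hup, hu, hu'⟩ := exists_corrector_of_lipschitz hH'.continuous (c := c)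
    (Λ := 2 * R) (by positivity) fun ε hε => by
      obtain ⟨u, huc, hup, hu0, huK, hu, hu'⟩ := hc ε hε
      exact ⟨u, hup, hu0, hlip u huc hup huK, hu, hu'⟩
  exact ⟨c, u, hup, isViscositySubsolution_iff.2 ⟨huc, hu⟩,
    isViscositySupersolution_iff.2 ⟨huc, hu'⟩⟩

end FlameSpeeds

/-! ### Comparison of the flame speeds -/

section Comparison
variable {n : ℕ} {V : Euc n → Euc n}

lemma IsKPP.reactionRate_pos {f : ℝ → ℝ} (hf : IsKPP f) : 0 < reactionRate f := by
  have h1 := hf.pos (1 / 2) (by constructor <;> norm_num)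
  have h2 := hf.le_linear (1 / 2) (by constructor <;> norm_num)
  linarith

/-- If `κ s ≤ s² + ρ` for all `s`, a corrector of the F-equation with slope `l p`, divided by `l`, is
a subsolution of the G-equation with slope `p` and amplitude `A / κ`. -/
theorem mul_speedG_le (hV : ContDiff ℝ 1 V) (hVp : TorusPeriodic V)
    (hdiv : ∀ x, ∑ i, (fderiv ℝ V x (EuclideanSpace.single i 1)) i = 0) (A : ℝ) (p : Euc n)
    {κ ρ l : ℝ} (hκ : 0 < κ) (hκρ : ∀ s : ℝ, κ * s ≤ s ^ 2 + ρ) (hl : 0 < l) :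
    κ * speedG V (A / κ) p ≤ (ρ + effectiveF V A (l • p)) / l := by
  obtain ⟨u, hup, hu, -⟩ := effectiveF_spec hV hVp A (l • p)
  obtain ⟨huc, hu⟩ := isViscositySubsolution_iff.1 hu
  set β := effectiveF V A (l • p)
  have hsub : IsViscositySubsolution
      (fun P x => hamiltonianG V (A / κ) (p + P) x - (ρ + β) / l / κ) (fun x => l⁻¹ * u x) := by
    refine isViscositySubsolution_iff.2 ⟨continuous_const.mul huc, fun φ hφ x₀ hmax => ?_⟩
    have h := hu.apply (contDiff_const.mul hφ) ((hφ.hasGradientAt x₀).const_mul_fun l) fun x => by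
      have h1 := mul_le_mul_of_nonneg_left (hmax x) hl.le
      rw [mul_sub, mul_sub, mul_inv_cancel_left₀ hl.ne', mul_inv_cancel_left₀ hl.ne'] at h1
      exact h1
    set P := gradient φ x₀
    simp only [hamiltonianF, ← smul_add, norm_smul, Real.norm_of_nonneg hl.le,
      inner_smul_right] at h
    have h2 := hκρ (l * ‖p + P‖)
    simp only [hamiltonianG, sub_nonpos]
    rw [le_div_iff₀ hκ, le_div_iff₀ hl]
    have h3 : (‖p + P‖ + A / κ * ⟪V x₀, p + P⟫) * κ * l =
        κ * (l * ‖p + P‖) + A * (l * ⟪V x₀, p + P⟫) := by field_simp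
    rw [h3]; linarith
  have h := le_of_admitsApprox_of_sub (isAdmissibleHamiltonian_G hV hVp (A / κ))
    (speedG_spec hV hVp hdiv (A / κ) p) (fun x k => by simp only [hup x k]) hsub
  rwa [le_div_iff₀' hκ] at h

lemma two_mul_sqrt_mul_le {ρ : ℝ} (hρ : 0 ≤ ρ) (s : ℝ) : 2 * √ρ * s ≤ s ^ 2 + ρ := by
  nlinarith [sq_nonneg (s - √ρ), Real.sq_sqrt hρ]

lemma bddBelow_speedMS (hV : ContDiff ℝ 1 V) (hVp : TorusPeriodic V)
    (hdiv : ∀ x, ∑ i, (fderiv ℝ V x (EuclideanSpace.single i 1)) i = 0) {f : ℝ → ℝ}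
    (hf : IsKPP f) (A : ℝ) (p : Euc n) :
    BddBelow (Set.range fun l : Set.Ioi (0 : ℝ) =>
      (reactionRate f + effectiveF V A ((l : ℝ) • p)) / (l : ℝ)) := by
  have hρ := hf.reactionRate_pos
  refine ⟨2 * √(reactionRate f) * speedG V (A / (2 * √(reactionRate f))) p, ?_⟩
  rintro _ ⟨l, rfl⟩
  exact mul_speedG_le hV hVp hdiv A p (by positivity) (two_mul_sqrt_mul_le hρ.le) l.2

end Comparison

/-! ### Shear flows -/

section Shear

/-- The shear flow `(v(x₂), 0)` in the plane. -/
noncomputable def shearFlow (v : ℝ → ℝ) : Euc 2 → Euc 2 := fun x => !₂[v (x 1), 0]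

lemma shearFlow_eq_smul (v : ℝ → ℝ) :
    shearFlow v = fun x => v (x 1) • (!₂[1, 0] : Euc 2) := by
  ext x i
  fin_cases i <;> simp [shearFlow]

lemma hasFDerivAt_apply_one (x : Euc 2) :
    HasFDerivAt (fun x : Euc 2 => x 1) (EuclideanSpace.proj 1 : Euc 2 →L[ℝ] ℝ) x :=
  (EuclideanSpace.proj 1 : Euc 2 →L[ℝ] ℝ).hasFDerivAt

lemma contDiff_shearFlow {v : ℝ → ℝ} (hv : ContDiff ℝ ∞ v) : ContDiff ℝ 1 (shearFlow v) := by
  rw [shearFlow_eq_smul]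
  have h1 : ContDiff ℝ 1 v := hv.of_le (by exact_mod_cast le_top)
  have h2 : ContDiff ℝ 1 (fun x : Euc 2 => x 1) :=
    (EuclideanSpace.proj 1 : Euc 2 →L[ℝ] ℝ).contDiff
  exact (h1.comp h2).smul contDiff_const

lemma Function.Periodic.map_add_intCast {v : ℝ → ℝ} (hv : Function.Periodic v 1) (y : ℝ) (k : ℤ) :
    v (y + k) = v y := by
  simpa using hv.int_mul k y

lemma torusPeriodic_shearFlow {v : ℝ → ℝ} (hv : Function.Periodic v 1) :
    TorusPeriodic (shearFlow v) := fun x k => by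
  simp [shearFlow, hv.map_add_intCast]

lemma div_shearFlow {v : ℝ → ℝ} (hv : ContDiff ℝ ∞ v) (x : Euc 2) :
    ∑ i, (fderiv ℝ (shearFlow v) x (EuclideanSpace.single i 1)) i = 0 := by
  have h1 : HasDerivAt v (deriv v (x 1)) (x 1) :=
    (hv.differentiable (by simp) (x 1)).hasDerivAt
  have h2 := (h1.comp_hasFDerivAt x (hasFDerivAt_apply_one x)).smul_const (!₂[1, 0] : Euc 2)
  rw [shearFlow_eq_smul]
  have h3 : fderiv ℝ (fun x : Euc 2 => v (x 1) • (!₂[1, 0] : Euc 2)) x = _ := h2.fderiv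
  rw [h3]
  simp [Fin.sum_univ_two]

lemma exists_eq_iSup_of_periodic {v : ℝ → ℝ} (hvc : Continuous v) (hv : Function.Periodic v 1) :
    ∃ y₀, v y₀ = ⨆ y, v y ∧ ∀ y, v y ≤ v y₀ := by
  obtain ⟨y₀, -, hy₀⟩ := (isCompact_Icc (a := (0 : ℝ)) (b := 1)).exists_isMaxOn
    ⟨0, by simp⟩ hvc.continuousOn
  have hmax : ∀ y, v y ≤ v y₀ := fun y => by
    obtain ⟨z, hz, hyz⟩ := hv.exists_mem_Ico₀ (by norm_num) y
    rw [hyz]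
    exact hy₀ ⟨hz.1, hz.2.le⟩
  exact ⟨y₀, le_antisymm (le_ciSup ⟨v y₀, by rintro _ ⟨y, rfl⟩; exact hmax y⟩ y₀) (ciSup_le hmax),
    hmax⟩

/-- A linear upper bound along a ray bounds the directional derivative. -/
lemma HasGradientAt.inner_le_of_ray {n : ℕ} {φ : Euc n → ℝ} {P x₀ e : Euc n} {c δ : ℝ}
    (h : HasGradientAt φ P x₀) (hδ : 0 < δ)
    (hle : ∀ s, 0 ≤ s → s ≤ δ → φ (x₀ + s • e) ≤ φ x₀ - c * s) : ⟪P, e⟫ ≤ -c := by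
  have h1 : HasDerivAt (fun s : ℝ => φ (x₀ + (δ - s) • e)) (-⟪P, e⟫) δ := by
    rw [hasGradientAt_iff_hasFDerivAt] at h
    have h2 : HasDerivAt (fun s : ℝ => x₀ + (δ - s) • e) (-e) δ := by
      simpa using (((hasDerivAt_id δ).const_sub δ).smul_const e).const_add x₀
    have h3 : x₀ + (δ - δ) • e = x₀ := by simp
    rw [← h3] at h
    refine (h.comp_hasDerivAt δ h2).congr_deriv ?_
    simp
  have h2 : HasDerivAt (fun s : ℝ => φ (x₀ + (δ - s) • e) + c * (δ - s)) (-⟪P, e⟫ + c * -1) δ :=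
    h1.add (((hasDerivAt_id δ).const_sub δ).const_mul c)
  have h3 := h2.nonneg_of_isMax_left hδ fun s hs0 hs => by
    have := hle (δ - s) (by linarith) (by linarith)
    simp only [sub_self, zero_smul, add_zero, mul_zero]
    linarith
  linarith

/-- `k` times the distance of `x₂` to `y₀ + ℤ`. -/
noncomputable def tentFunction (k y₀ : ℝ) (x : Euc 2) : ℝ :=
  k * ‖((x 1 - y₀ : ℝ) : UnitAddCircle)‖

lemma continuous_tentFunction (k y₀ : ℝ) : Continuous (tentFunction k y₀) := by
  have : Continuous fun x : Euc 2 => ((x 1 - y₀ : ℝ) : UnitAddCircle) :=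
    (AddCircle.continuous_mk' (1 : ℝ)).comp (by fun_prop)
  exact continuous_const.mul this.norm

lemma torusPeriodic_tentFunction (k y₀ : ℝ) : TorusPeriodic (tentFunction k y₀) := fun x m => by
  have h : ((m 1 : ℝ) : UnitAddCircle) = 0 :=
    (AddCircle.coe_eq_zero_iff (1 : ℝ)).2 ⟨m 1, by simp⟩
  have : (x + WithLp.toLp 2 (fun i => (m i : ℝ))) 1 - y₀ = (x 1 - y₀) + m 1 := by
    simp; ring
  rw [tentFunction, this, AddCircle.coe_add, h, add_zero, tentFunction]

/-- Gradients of functions touching the tent function from below are vertical. They have slope at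
least `k`, except at the bottom `x₂ ∈ y₀ + ℤ`; there are none at the top. -/
lemma tentFunction_touching {k y₀ : ℝ} (hk : 0 ≤ k) {φ : Euc 2 → ℝ} {P x₀ : Euc 2}
    (hP : HasGradientAt φ P x₀)
    (hmin : ∀ x, tentFunction k y₀ x₀ - φ x₀ ≤ tentFunction k y₀ x - φ x) :
    P 0 = 0 ∧ ((∃ m : ℤ, x₀ 1 = y₀ + m) ∨ k ≤ |P 1|) := by
  have hinner0 : ∀ a : ℝ, ⟪P, !₂[a, 0]⟫ = a * P 0 := fun a => by
    simp [PiLp.inner_apply, Fin.sum_univ_two]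
  have hinner1 : ∀ a : ℝ, ⟪P, !₂[0, a]⟫ = a * P 1 := fun a => by
    simp [PiLp.inner_apply, Fin.sum_univ_two]
  have hhor : ∀ a : ℝ, a * P 0 ≤ 0 := fun a => by
    rw [← hinner0]
    have := hP.inner_le_of_ray (e := !₂[a, 0]) (c := 0) one_pos fun s _ _ => by
      have h1 := hmin (x₀ + s • !₂[a, 0])
      have h2 : tentFunction k y₀ (x₀ + s • !₂[a, 0]) = tentFunction k y₀ x₀ := by
        simp [tentFunction]
      linarith
    linarith
  refine ⟨by linarith [hhor 1, hhor (-1)], ?_⟩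
  set t : ℝ := x₀ 1 - y₀ with ht
  set δ : ℝ := t - round t with hδ
  have hT₀ : tentFunction k y₀ x₀ = k * |δ| := by
    rw [tentFunction, UnitAddCircle.norm_eq]
  -- moving towards `y₀ + ℤ` decreases the tent function at rate `k`
  have hdec : ∀ σ : ℝ, |σ| = 1 → 0 < σ * δ → ∀ s, 0 ≤ s → s ≤ |δ| →
      φ (x₀ + s • !₂[0, -σ]) ≤ φ x₀ - k * s := by
    intro σ hσ hσδ s hs hsδ
    have h1 := hmin (x₀ + s • !₂[0, -σ])
    have h2 : tentFunction k y₀ (x₀ + s • !₂[0, -σ]) ≤ k * (|δ| - s) := by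
      have h3 : (x₀ + s • (!₂[0, -σ] : Euc 2)) 1 - y₀ = t - s * σ := by
        simp [ht]; ring
      rw [tentFunction, h3, UnitAddCircle.norm_eq]
      refine mul_le_mul_of_nonneg_left ((round_le (t - s * σ) (round t)).trans ?_) hk
      have h4 : t - s * σ - round t = δ - s * σ := by simp only [hδ]; ring
      rw [h4]
      rcases (abs_eq one_pos.le).1 hσ with rfl | rfl
      · have : 0 < δ := by linarith
        rw [abs_of_pos this] at *
        rw [abs_of_nonneg (by linarith)]; linarith
      · have : δ < 0 := by linarith
        rw [abs_of_neg this] at *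
        rw [abs_of_nonpos (by linarith)]; linarith
    rw [hT₀] at h1
    linarith
  rcases lt_trichotomy δ 0 with h | h | h
  · right
    have := hP.inner_le_of_ray (abs_pos.2 h.ne) (hdec (-1) (by simp) (by linarith))
    rw [hinner1] at this
    have h5 := neg_abs_le (P 1)
    linarith
  · left
    exact ⟨round t, by simp only [hδ, ht] at h ⊢; linarith⟩
  · right
    have := hP.inner_le_of_ray (abs_pos.2 h.ne') (hdec 1 (by simp) (by linarith))
    rw [hinner1] at this
    have h5 := le_abs_self (P 1)
    linarith

lemma inner_shearFlow (v : ℝ → ℝ) (l : ℝ) {P : Euc 2} (hP : P 0 = 0) (x : Euc 2) :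
    ⟪shearFlow v x, l • (!₂[1, 0] : Euc 2) + P⟫ = l * v (x 1) := by
  simp [PiLp.inner_apply, Fin.sum_univ_two, shearFlow, hP]

lemma norm_sq_smul_add {l : ℝ} {P : Euc 2} (hP : P 0 = 0) :
    ‖l • (!₂[1, 0] : Euc 2) + P‖ ^ 2 = l ^ 2 + P 1 ^ 2 := by
  simp [EuclideanSpace.norm_sq_eq, Fin.sum_univ_two, hP]

lemma isViscositySubsolution_zero {n : ℕ} {H : Euc n → Euc n → ℝ} (h : ∀ x, H 0 x ≤ 0) :
    IsViscositySubsolution H (fun _ => 0) := by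
  refine isViscositySubsolution_iff.2 ⟨continuous_const, fun φ hφ x₀ hmax => ?_⟩
  have h1 : gradient φ x₀ = 0 := gradient_eq_zero_of_isMin fun x => by
    have := hmax x; linarith
  simpa only [h1] using h x₀

variable {v : ℝ → ℝ}

lemma speedG_shearFlow (hv : ContDiff ℝ ∞ v) (hvp : Function.Periodic v 1) {A : ℝ} (hA : 0 < A) :
    speedG (shearFlow v) A !₂[1, 0] = 1 + A * ⨆ y, v y := by
  obtain ⟨y₀, hy₀, hmax⟩ := exists_eq_iSup_of_periodic hv.continuous hvp
  have hVp := torusPeriodic_shearFlow hvp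
  have hH := isAdmissibleHamiltonian_G (contDiff_shearFlow hv) hVp A
  have hspec := speedG_spec (contDiff_shearFlow hv) hVp (div_shearFlow hv) A !₂[1, 0]
  rw [← hy₀]
  have hone : (!₂[1, 0] : Euc 2) = (1 : ℝ) • !₂[1, 0] := (one_smul _ _).symm
  refine le_antisymm ?_ ?_
  · refine le_of_admitsApprox_of_sub hH hspec (u := fun _ => 0) (fun _ _ => rfl)
      (isViscositySubsolution_zero fun x => ?_)
    have h1 := norm_sq_smul_add (l := 1) (P := 0) rfl
    have h2 : ‖(!₂[1, 0] : Euc 2) + 0‖ = 1 := by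
      rw [one_smul] at h1
      rw [← Real.sqrt_sq (norm_nonneg _), h1]; simp
    have h3 := inner_shearFlow v 1 (P := 0) rfl x
    rw [one_smul] at h3
    simp only [hamiltonianG, h2, h3, one_mul]
    linarith [mul_le_mul_of_nonneg_left (hmax (x 1)) hA.le]
  · obtain ⟨B, hB⟩ : ∃ B, ∀ y, -B ≤ v y := by
      obtain ⟨z, -, hz⟩ := exists_eq_iSup_of_periodic (v := fun y => - v y)
        hv.continuous.neg (fun y => by simp only [hvp y])
      exact ⟨- v z, fun y => by have := hz y; linarith⟩
    have hBM : 0 ≤ v y₀ + B := by linarith [hB y₀]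
    refine le_of_admitsApprox_of_super hH hspec
      (torusPeriodic_tentFunction (1 + A * (v y₀ + B)) y₀)
      (isViscositySupersolution_iff.2 ⟨continuous_tentFunction _ _, fun φ hφ x₀ hmin => ?_⟩)
    obtain ⟨h0, h1⟩ := tentFunction_touching (by positivity) (hφ.hasGradientAt x₀) hmin
    set P := gradient φ x₀
    have hn := norm_sq_smul_add (l := 1) h0
    have hi := inner_shearFlow v 1 h0 x₀
    rw [one_smul] at hn hi
    simp only [hamiltonianG, hi, one_mul]
    have hnn := norm_nonneg ((!₂[1, 0] : Euc 2) + P)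
    rcases h1 with ⟨m, hm⟩ | h1
    · rw [hm, hvp.map_add_intCast]
      have : 1 ≤ ‖(!₂[1, 0] : Euc 2) + P‖ := by nlinarith [sq_nonneg (P 1)]
      linarith
    · have h2 : |P 1| ≤ ‖(!₂[1, 0] : Euc 2) + P‖ := by
        refine abs_le_of_sq_le_sq (by rw [hn]; linarith) hnn
      nlinarith [mul_le_mul_of_nonneg_left (hB (x₀ 1)) hA.le]

lemma effectiveF_shearFlow (hv : ContDiff ℝ ∞ v) (hvp : Function.Periodic v 1) {A : ℝ}
    (hA : 0 < A) {l : ℝ} (hl : 0 < l) :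
    effectiveF (shearFlow v) A (l • (!₂[1, 0] : Euc 2)) = l ^ 2 + A * l * ⨆ y, v y := by
  obtain ⟨y₀, hy₀, hmax⟩ := exists_eq_iSup_of_periodic hv.continuous hvp
  have hVp := torusPeriodic_shearFlow hvp
  have hH := isAdmissibleHamiltonian_F (contDiff_shearFlow hv) hVp A
  have hspec := (effectiveF_spec (contDiff_shearFlow hv) hVp A
    (l • (!₂[1, 0] : Euc 2))).admitsApprox
  rw [← hy₀]
  have hAl : 0 ≤ A * l := by positivity
  refine le_antisymm ?_ ?_
  · refine le_of_admitsApprox_of_sub hH hspec (u := fun _ => 0) (fun _ _ => rfl)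
      (isViscositySubsolution_zero fun x => ?_)
    simp only [hamiltonianF, norm_sq_smul_add (l := l) (P := 0) rfl,
      inner_shearFlow v l (P := 0) rfl x]
    have := mul_le_mul_of_nonneg_left (hmax (x 1)) hAl
    simp only [PiLp.zero_apply]
    linarith
  · obtain ⟨B, hB⟩ : ∃ B, ∀ y, -B ≤ v y := by
      obtain ⟨z, -, hz⟩ := exists_eq_iSup_of_periodic (v := fun y => - v y)
        hv.continuous.neg (fun y => by simp only [hvp y])
      exact ⟨- v z, fun y => by have := hz y; linarith⟩
    have hBM : 0 ≤ A * l * (v y₀ + B) := mul_nonneg hAl (by linarith [hB y₀])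
    refine le_of_admitsApprox_of_super hH hspec
      (torusPeriodic_tentFunction (1 + A * l * (v y₀ + B)) y₀)
      (isViscositySupersolution_iff.2 ⟨continuous_tentFunction _ _, fun φ hφ x₀ hmin => ?_⟩)
    obtain ⟨h0, h1⟩ := tentFunction_touching (by positivity) (hφ.hasGradientAt x₀) hmin
    set P := gradient φ x₀
    simp only [hamiltonianF, norm_sq_smul_add (l := l) h0, inner_shearFlow v l h0 x₀]
    rcases h1 with ⟨m, hm⟩ | h1
    · rw [hm, hvp.map_add_intCast]
      nlinarith [sq_nonneg (P 1)]
    · have h2 : 1 + A * l * (v y₀ + B) ≤ P 1 ^ 2 := by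
        rw [← sq_abs]; nlinarith
      linarith [mul_le_mul_of_nonneg_left (hB (x₀ 1)) hAl]

lemma speedMS_shearFlow {f : ℝ → ℝ} (hf : IsKPP f) (hv : ContDiff ℝ ∞ v)
    (hvp : Function.Periodic v 1) {A : ℝ} (hA : 0 < A) :
    speedMS f (shearFlow v) A !₂[1, 0] = A * (⨆ y, v y) + 2 * √(reactionRate f) := by
  have hρ := hf.reactionRate_pos
  have hbdd := bddBelow_speedMS (contDiff_shearFlow hv) (torusPeriodic_shearFlow hvp)
    (div_shearFlow hv) hf A !₂[1, 0]
  have hs : 0 < √(reactionRate f) := Real.sqrt_pos.2 hρ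
  refine le_antisymm ?_ ?_
  · refine (ciInf_le hbdd ⟨√(reactionRate f), hs⟩).trans (le_of_eq ?_)
    simp only [effectiveF_shearFlow hv hvp hA hs]
    rw [div_eq_iff hs.ne']
    linear_combination -Real.sq_sqrt hρ.le
  · have : Nonempty (Set.Ioi (0 : ℝ)) := ⟨⟨1, Set.mem_Ioi.2 one_pos⟩⟩
    refine le_ciInf fun ⟨l, hl⟩ => ?_
    have hl' : 0 < l := hl
    simp only [effectiveF_shearFlow hv hvp hA hl']
    rw [le_div_iff₀ hl']
    linarith [two_mul_sqrt_mul_le hρ.le l]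

end Shear

/-! ### The estimates -/

theorem lemma3p1 (f : ℝ → ℝ) (hf : IsKPP f) (A : ℝ) (hA : 0 < A) :
    -- the two-sided estimate and its consequence for `f'(0) ≥ 1/4`, for general flows
    (∀ (n : ℕ) (V : EuclideanSpace ℝ (Fin n) → EuclideanSpace ℝ (Fin n)),
      IsIncompressibleFlow V → ∀ p : EuclideanSpace ℝ (Fin n),
        (2 * √(reactionRate f)) * speedG V (A / (2 * √(reactionRate f))) p ≤ speedMS f V A p ∧
        speedMS f V A p ≤ effectiveF V A p + reactionRate f ∧
        (1 / 4 ≤ reactionRate f → speedG V A p ≤ speedMS f V A p)) ∧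
    -- shear flows `V(x₁, x₂) = (v(x₂), 0)` with `p = (1, 0)`: failure for `f'(0) < 1/4`
    (∀ v : ℝ → ℝ, ContDiff ℝ ∞ v → Function.Periodic v 1 → (∫ y in (0 : ℝ)..1, v y) = 0 →
      speedG (fun x : EuclideanSpace ℝ (Fin 2) => !₂[v (x 1), 0]) A !₂[1, 0]
          = 1 + A * (⨆ y, v y) ∧
      (∀ l : ℝ, 0 < l →
        effectiveF (fun x : EuclideanSpace ℝ (Fin 2) => !₂[v (x 1), 0]) A
            (l • (!₂[1, 0] : EuclideanSpace ℝ (Fin 2)))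
          = l ^ 2 + A * l * (⨆ y, v y)) ∧
      speedMS f (fun x : EuclideanSpace ℝ (Fin 2) => !₂[v (x 1), 0]) A !₂[1, 0]
          = A * (⨆ y, v y) + 2 * √(reactionRate f) ∧
      (reactionRate f < 1 / 4 →
        speedMS f (fun x : EuclideanSpace ℝ (Fin 2) => !₂[v (x 1), 0]) A !₂[1, 0]
          < speedG (fun x : EuclideanSpace ℝ (Fin 2) => !₂[v (x 1), 0]) A !₂[1, 0])) := by
  have hρ := hf.reactionRate_pos
  refine ⟨fun n V hV p => ?_, fun v hv hvp _ => ?_⟩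
  · have hV1 : ContDiff ℝ 1 V := hV.smooth.of_le (by exact_mod_cast le_top)
    have : Nonempty (Set.Ioi (0 : ℝ)) := ⟨⟨1, Set.mem_Ioi.2 one_pos⟩⟩
    refine ⟨le_ciInf fun l => ?_, ?_, fun h4 => le_ciInf fun l => ?_⟩
    · exact mul_speedG_le hV1 hV.periodic hV.div_free A p (by positivity)
        (two_mul_sqrt_mul_le hρ.le) l.2
    · refine (ciInf_le (bddBelow_speedMS hV1 hV.periodic hV.div_free hf A p)
        ⟨1, Set.mem_Ioi.2 one_pos⟩).trans (le_of_eq ?_)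
      simp only [one_smul, div_one]
      ring
    · have := mul_speedG_le hV1 hV.periodic hV.div_free A p (κ := 1) (ρ := reactionRate f)
        one_pos (fun s => by nlinarith [sq_nonneg (s - 1 / 2)]) l.2
      simpa using this
  · have hG := speedG_shearFlow hv hvp hA
    have hMS := speedMS_shearFlow hf hv hvp hA
    refine ⟨hG, fun l hl => effectiveF_shearFlow hv hvp hA hl, hMS, fun h4 => ?_⟩
    have h1 : √(reactionRate f) < 1 / 2 := by
      rw [Real.sqrt_lt' (by norm_num)]; linarith
    change speedMS f (shearFlow v) A !₂[1, 0] < speedG (shearFlow v) A !₂[1, 0]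
    rw [hG, hMS]
    linarith
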